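/- Let $(Y(i))_{i\ge 1}$ be a stationary centred Gaussian process with variance $1$ whose correlation function $\rho$ satisfies $|\rho(i)|\sim i^{-\alpha}$ as $i\to\infty$, for some $\alpha>0$. Let $g:\mathbb{R}\to\mathbb{R}$ be measurable, let $Y$ be a standard Gaussian variable, let $F(u)=P(g(Y)\le u)$, let $0<p<1$ and let $\xi(p)=\inf\{x: F(x)\ge p\}$. Assume that there are $L\ge 1$ and pairwise disjoint open sets $U_1,\dots,U_L\subset\mathbb{R}$ such that each $U_i$ contains exactly one solution $t$ of $g(t)=\xi(p)$, such that $g$ restricted to each $U_i$ is a $\mathcal{C}^1$-diffeomorphism onto an open set, and such that $F$ is differentiable at $\xi(p)$ with $f(\xi(p)):=F'(\xi(p))>0$. For $u\in\mathbb{R}$ let $h_u(t)=\mathbf{1}_{\{g(t)\le u\}}-F(u)$, and let $\tau(u)=\inf\{j\ge 0: E(h_u(Y)H_j(Y))\neq 0\}$ be its Hermite rank (with $\inf\emptyset=\infty$), where $H_j$ is the $j$-th Hermite polynomial, normalised by $E(H_j(Y)H_k(Y))=j!\,\delta_{jk}$. Put $\overline{\tau}_p=\inf\{\tau(\gamma):\gamma\in\bigcup_{i=1}^L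 g(U_i)\}$. Let $\widehat F_n(x)=\frac1n\#\{1\le i\le n: g(Y(i))\le x\}$ and $\widehat\xi_n(p)=\inf\{x:\widehat F_n(x)\ge p\}$. Then, as $n\to\infty$, $$\widehat\xi_n(p)-\xi(p)=\frac{p-\widehat F_n(\xi(p))}{f(\xi(p))}+o_{\mathbb P}(r_n),\qquad r_n=\begin{cases} n^{-1/2} & \text{if }\alpha\overline{\tau}_p>1,\\ n^{-1/2}(\log n)^{1/2} & \text{if }\alpha\overline{\tau}_p=1,\\ n^{-\alpha\overline{\tau}_p/2} & \text{if }\alpha\overline{\tau}_p<1,\end{cases}$$ where $X_n=o_{\mathbb P}(r_n)$ means that $X_n/r_n\to 0$ in probability. -/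

import Mathlib

open MeasureTheory ProbabilityTheory Filter Topology

noncomputable section

namespace GaussBahadur

/-- The quantile of order `p` associated with a distribution function `F`:
`inf {x | p ≤ F x}`. -/
def quantile (F : ℝ → ℝ) (p : ℝ) : ℝ := sInf {x : ℝ | p ≤ F x}

/-- The distribution function `F_{g(Y)}(u) = P(g(Y) ≤ u)`, `Y` a standard Gaussian variable. -/
def cdfG (g : ℝ → ℝ) (u : ℝ) : ℝ := cdf ((gaussianReal 0 1).map g) u

/-- The quantile `ξ(p)` of `g(Y)`, `Y` a standard Gaussian variable. -/
def xi (g : ℝ → ℝ) (p : ℝ) : ℝ := quantile (cdfG g) p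

/-- The value at `u` of the density of `g(Y)`, as the derivative of its distribution function. -/
def densG (g : ℝ → ℝ) (u : ℝ) : ℝ := deriv (cdfG g) u

open Classical in
/-- The sample distribution function of the first `n` terms of a real sequence `y`:
the proportion of the terms that are at most `x`. -/
def sampleCdf (n : ℕ) (y : ℕ → ℝ) (x : ℝ) : ℝ :=
  (((Finset.range n).filter (fun i => y i ≤ x)).card : ℝ) / (n : ℝ)

/-- The sample quantile of order `p` of the first `n` terms of a real sequence `y`. -/
def sampleQuantile (n : ℕ) (y : ℕ → ℝ) (p : ℝ) : ℝ := quantile (sampleCdf n y) p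

/-- The Hermite coefficient `c_j = E (h(Y) H_j(Y))`, `Y` a standard Gaussian variable and
`H_j` the (probabilists') Hermite polynomial, normalised by `E (H_j(Y) H_k(Y)) = j! δ_{jk}`. -/
def hermiteCoeff (h : ℝ → ℝ) (j : ℕ) : ℝ :=
  ∫ t, h t * Polynomial.aeval t (Polynomial.hermite j) ∂(gaussianReal 0 1)

/-- The Hermite rank `inf {j ≥ 0 | c_j ≠ 0}`, with the convention `inf ∅ = ∞`. -/
def hermiteRank (h : ℝ → ℝ) : ℕ∞ :=
  sInf {m : ℕ∞ | ∃ j : ℕ, hermiteCoeff h j ≠ 0 ∧ m = (j : ℕ∞)}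

open Classical in
/-- The centred indicator `h_u(t) = 1_{g(t) ≤ u} - F_{g(Y)}(u)`. -/
def hInd (g : ℝ → ℝ) (u t : ℝ) : ℝ := (if g t ≤ u then 1 else 0) - cdfG g u

/-- `g` restricts to a `C¹`-diffeomorphism from the open set `U` onto an open subset of `ℝ`. -/
def IsC1DiffeoOn (g : ℝ → ℝ) (U : Set ℝ) : Prop :=
  ∃ e : OpenPartialHomeomorph ℝ ℝ, e.source = U ∧ Set.EqOn e g U ∧
    ContDiffOn ℝ 1 e e.source ∧ ContDiffOn ℝ 1 e.symm e.target

/-- The assumption `A(ξ(p))` on `g`, for the sets `U_1, …, U_L`. -/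
structure AssumptionA (g : ℝ → ℝ) (p : ℝ) {L : ℕ} (U : Fin L → Set ℝ) : Prop where
  one_le : 1 ≤ L
  isOpen : ∀ i, IsOpen (U i)
  disjoint : ∀ i j, i ≠ j → Disjoint (U i) (U j)
  unique_sol : ∀ i, ∃! t, t ∈ U i ∧ g t = xi g p
  deriv_pos : 0 < deriv (cdfG g) (xi g p)
  diffeo : ∀ i, IsC1DiffeoOn g (U i)

/-- The minimal Hermite rank of `h_γ` for `γ` in the union of the sets `g(U_i)`. -/
def tauBar (g : ℝ → ℝ) {L : ℕ} (U : Fin L → Set ℝ) : ℕ∞ :=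
  ⨅ γ ∈ ⋃ i, g '' U i, hermiteRank (hInd g γ)

/-- The rate `r_n(α, τ)`; an infinite `τ` belongs to the case `α τ > 1`. -/
def rate (α : ℝ) : ℕ∞ → ℕ → ℝ
  | none, n => (n : ℝ) ^ (-(1 / 2) : ℝ)
  | some τ, n =>
    if 1 < α * (τ : ℝ) then (n : ℝ) ^ (-(1 / 2) : ℝ)
    else if α * (τ : ℝ) = 1 then (n : ℝ) ^ (-(1 / 2) : ℝ) * (Real.log n) ^ (1 / 2 : ℝ)
    else (n : ℝ) ^ (-(α * (τ : ℝ) / 2))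

/-- `Y 0, Y 1, …` (the terms `Y(1), Y(2), …` of the sequence) is a stationary centred Gaussian
process with variance `1` and correlation function `ρ`. -/
structure IsStationaryGaussian {Ω : Type*} [MeasurableSpace Ω] (P : Measure Ω)
    (Y : ℕ → Ω → ℝ) (ρ : ℕ → ℝ) : Prop where
  gaussian : IsGaussianProcess Y P
  mean_zero : ∀ i, ∫ ω, Y i ω ∂P = 0
  variance_one : ∀ i, variance (Y i) P = 1
  cov_eq : ∀ i k, covariance (Y i) (Y (i + k)) P = ρ k

/-- `X n = o_P(r n)`: the sequence `X n / r n` tends to `0` in probability. -/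
def IsLittleOInProb {Ω : Type*} [MeasurableSpace Ω] (P : Measure Ω)
    (X : ℕ → Ω → ℝ) (r : ℕ → ℝ) : Prop :=
  TendstoInMeasure P (fun n ω => X n ω / r n) atTop (fun _ => (0 : ℝ))

end GaussBahadur

end

/-! ### Gaussian integration by parts and the bivariate Gaussian law -/

namespace GaussBahadur

/-! Write θ = ξ(p), f = F'(θ), G_n for the sample distribution function and R_n for the rate. Since
F is continuous at θ, F(θ) = p. The sample quantile is at most x when G_n(x) ≥ p and at least x when
G_n(x) < p, so it is located by the values of G_n at a few points θ + R_n y. If G_n(θ) - p =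
O_P(R_n), and if for each fixed y the increment of G_n - F from θ to θ + R_n y is o_P(R_n), then
G_n(θ + R_n y) = G_n(θ) + f R_n y + o_P(R_n). On a fine finite grid of values y this traps the
quantile near θ + (p - G_n(θ))/f (`tendstoInMeasure_bahadur`).

Both inputs are second moment bounds. For a Gaussian pair of correlation r and a function h with
vanishing Hermite coefficients below m, |E h(X)h(Y)| ≤ |r|^m E h² (`abs_integral_gaussianPair_le`):
Hermite polynomials are complete in L² of the Gaussian law, and the correlation acts diagonally on
them with eigenvalues r^j. Summing over pairs, the mean of h(Y(i)) has second moment at most (2/n) Σ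
|ρ(k)|^m E h², which is O(R_n²) E h². With h = h_θ this gives tightness. With h = h_u - h_θ, u = θ +
R_n y, it gives the increment bound, because E h² ≤ |F(u) - F(θ)| tends to 0. The rank of this
difference is controlled because the union of the g(U_i) is a neighbourhood of θ, hence eventually
contains u. -/

lemma integrable_polynomial_gaussian (p : Polynomial ℝ) :
    Integrable (fun x => p.eval x) (gaussianReal 0 1) := by
  induction p using Polynomial.induction_on' with
  | add p q hp hq =>
    simp only [Polynomial.eval_add]
    exact hp.add hq
  | monomial n a =>
    have h : Integrable (fun x : ℝ => x ^ n) (gaussianReal 0 1) :=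
      integrable_pow_of_mem_interior_integrableExpSet (X := fun x : ℝ => x) (by simp) n
    simpa using h.const_mul a

lemma memLp_polynomial_gaussian (p : Polynomial ℝ) :
    MemLp (fun x => p.eval x) 2 (gaussianReal 0 1) := by
  rw [memLp_two_iff_integrable_sq (by fun_prop)]
  refine (integrable_polynomial_gaussian (p ^ 2)).congr (ae_of_all _ fun x => ?_)
  simp

lemma hasDerivAt_gaussianPDFReal (x : ℝ) :
    HasDerivAt (gaussianPDFReal 0 1) (-x * gaussianPDFReal 0 1 x) x := by
  have h : HasDerivAt (fun x : ℝ => -(x - 0) ^ 2 / (2 * ((1 : NNReal) : ℝ))) (-x) x := by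
    have := ((((hasDerivAt_id x).sub_const 0).pow 2).neg).div_const (2 * ((1 : NNReal) : ℝ))
    refine this.congr_deriv ?_
    simp
    ring
  have := (h.exp).const_mul ((√(2 * Real.pi * ((1 : NNReal) : ℝ)))⁻¹)
  rw [gaussianPDFReal_def]
  refine this.congr_deriv ?_
  simp only []
  ring

lemma integrable_polynomial_mul_gaussianPDFReal (p : Polynomial ℝ) :
    Integrable (fun x => p.eval x * gaussianPDFReal 0 1 x) := by
  have h := integrable_polynomial_gaussian p
  rw [gaussianReal_of_var_ne_zero _ one_ne_zero,
    integrable_withDensity_iff (by fun_prop) (ae_of_all _ fun _ => by simp [gaussianPDF])] at h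
  refine h.congr (ae_of_all _ fun x => ?_)
  simp [gaussianPDF, ENNReal.toReal_ofReal (gaussianPDFReal_nonneg 0 1 x)]

/-- Gaussian integration by parts for polynomials. -/
lemma integral_stein (p : Polynomial ℝ) :
    ∫ x, (Polynomial.X * p - Polynomial.derivative p).eval x ∂(gaussianReal 0 1) = 0 := by
  rw [integral_gaussianReal_eq_integral_smul one_ne_zero]
  -- The Gaussian density φ satisfies φ' = -xφ, so minus the integrand is the derivative of pφ.
  have h := integral_eq_zero_of_hasDerivAt_of_integrable
    (fun x => (p.hasDerivAt x).mul (hasDerivAt_gaussianPDFReal x))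
    (?_) (integrable_polynomial_mul_gaussianPDFReal p)
  · rw [← neg_eq_zero, ← integral_neg]
    refine Eq.trans ?_ h
    refine integral_congr_ae (ae_of_all _ fun x => ?_)
    simp
    ring
  · refine (integrable_polynomial_mul_gaussianPDFReal
      (Polynomial.derivative p - Polynomial.X * p)).congr (ae_of_all _ fun x => ?_)
    simp
    ring

/-- The standard bivariate Gaussian law with correlation `r`. -/
noncomputable def gaussianPair (r : ℝ) : Measure (ℝ × ℝ) :=
  ((gaussianReal 0 1).prod (gaussianReal 0 1)).map
    (fun z => (z.1, r * z.1 + √(1 - r ^ 2) * z.2))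

instance (r : ℝ) : IsProbabilityMeasure (gaussianPair r) :=
  Measure.isProbabilityMeasure_map (by fun_prop)

/-- The characteristic function of a Gaussian pair involves only the mean and variance of linear
functionals; these reduce to five parameters. -/
lemma integral_and_variance_strongDual {Ω : Type*} [MeasurableSpace Ω] {P : Measure Ω}
    {X Y : Ω → ℝ} (h : HasGaussianLaw (fun ω => (X ω, Y ω)) P) (L : StrongDual ℝ (ℝ × ℝ)) :
    (∫ ω, L (X ω, Y ω) ∂P = L (1, 0) * ∫ ω, X ω ∂P + L (0, 1) * ∫ ω, Y ω ∂P) ∧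
      variance (fun ω => L (X ω, Y ω)) P = L (1, 0) ^ 2 * variance X P
        + 2 * (L (1, 0) * L (0, 1) * covariance X Y P) + L (0, 1) ^ 2 * variance Y P := by
  have := h.isProbabilityMeasure
  have hL : (fun ω => L (X ω, Y ω)) = fun ω => L (1, 0) * X ω + L (0, 1) * Y ω := by
    ext ω
    have : (X ω, Y ω) = X ω • ((1 : ℝ), (0 : ℝ)) + Y ω • ((0 : ℝ), (1 : ℝ)) := by simp
    rw [this, map_add, map_smul, map_smul]
    simp [mul_comm]
  have mX := h.fst.memLp_two
  have mY := h.snd.memLp_two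
  constructor
  · rw [hL, integral_add (h.fst.integrable.const_mul _) (h.snd.integrable.const_mul _),
      integral_const_mul, integral_const_mul]
  · rw [hL, variance_fun_add (mX.const_mul _) (mY.const_mul _), variance_const_mul,
      variance_const_mul, covariance_const_mul_left, covariance_const_mul_right]
    ring

/-- A centred Gaussian pair is determined in law by its covariances. -/
lemma map_prodMk_eq_of_hasGaussianLaw {Ω Ω' : Type*} [MeasurableSpace Ω] [MeasurableSpace Ω']
    {P : Measure Ω} {Q : Measure Ω'} {X Y : Ω → ℝ} {X' Y' : Ω' → ℝ}
    (h : HasGaussianLaw (fun ω => (X ω, Y ω)) P) (h' : HasGaussianLaw (fun ω => (X' ω, Y' ω)) Q)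
    (hX : ∫ ω, X ω ∂P = ∫ ω, X' ω ∂Q) (hY : ∫ ω, Y ω ∂P = ∫ ω, Y' ω ∂Q)
    (vX : variance X P = variance X' Q) (vY : variance Y P = variance Y' Q)
    (c : covariance X Y P = covariance X' Y' Q) :
    P.map (fun ω => (X ω, Y ω)) = Q.map (fun ω => (X' ω, Y' ω)) := by
  have := h.isProbabilityMeasure
  have := h'.isProbabilityMeasure
  have := h.isGaussian_map
  have := h'.isGaussian_map
  refine Measure.ext_of_charFunDual ?_
  ext L
  rw [h.charFunDual_map_eq_fun, h'.charFunDual_map_eq_fun, (integral_and_variance_strongDual h L).1,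
    (integral_and_variance_strongDual h L).2, (integral_and_variance_strongDual h' L).1,
    (integral_and_variance_strongDual h' L).2, hX, hY, vX, vY, c]

/-- The representation (X, rX + √(1 - r²) Z) has no density when r = ±1, yet still covers those
cases, so no nondegeneracy is needed. -/
lemma map_prodMk_eq_gaussianPair {Ω : Type*} [MeasurableSpace Ω] {P : Measure Ω}
    {X Y : Ω → ℝ} {r : ℝ} (h : HasGaussianLaw (fun ω => (X ω, Y ω)) P)
    (hX : ∫ ω, X ω ∂P = 0) (hY : ∫ ω, Y ω ∂P = 0) (vX : variance X P = 1)
    (vY : variance Y P = 1) (c : covariance X Y P = r) (hr : r ^ 2 ≤ 1) :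
    P.map (fun ω => (X ω, Y ω)) = gaussianPair r := by
  set Q := (gaussianReal 0 1).prod (gaussianReal 0 1) with hQ
  have hf : Q.map Prod.fst = gaussianReal 0 1 := by simp [hQ]
  have hs : Q.map Prod.snd = gaussianReal 0 1 := by simp [hQ]
  have lf : HasGaussianLaw (Prod.fst : ℝ × ℝ → ℝ) Q := ⟨by rw [hf]; infer_instance⟩
  have ls : HasGaussianLaw (Prod.snd : ℝ × ℝ → ℝ) Q := ⟨by rw [hs]; infer_instance⟩
  have hind : IndepFun (Prod.fst : ℝ × ℝ → ℝ) Prod.snd Q :=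
    indepFun_prod (X := id) (Y := id) measurable_id measurable_id
  have h2 : HasGaussianLaw (fun z : ℝ × ℝ => z) Q := hind.hasGaussianLaw lf ls
  let T : ℝ × ℝ →L[ℝ] ℝ × ℝ := (ContinuousLinearMap.fst ℝ ℝ ℝ).prod
    (r • ContinuousLinearMap.fst ℝ ℝ ℝ + √(1 - r ^ 2) • ContinuousLinearMap.snd ℝ ℝ ℝ)
  have hT : HasGaussianLaw (fun z : ℝ × ℝ => (z.1, r * z.1 + √(1 - r ^ 2) * z.2)) Q := by
    simpa [T] using h2.map_fun T
  have if0 : ∫ z, z.1 ∂Q = 0 := by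
    have := integral_map (μ := Q) measurable_fst.aemeasurable (f := fun x : ℝ => x) (by fun_prop)
    rw [← this, hf]; simp
  have is0 : ∫ z, z.2 ∂Q = 0 := by
    have := integral_map (μ := Q) measurable_snd.aemeasurable (f := fun x : ℝ => x) (by fun_prop)
    rw [← this, hs]; simp
  have vf : variance (fun z : ℝ × ℝ => z.1) Q = 1 := by
    have := variance_map (μ := Q) (X := fun x : ℝ => x) (by fun_prop) measurable_fst.aemeasurable
    rw [hf, variance_fun_id_gaussianReal] at this
    exact this.symm
  have vs : variance (fun z : ℝ × ℝ => z.2) Q = 1 := by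
    have := variance_map (μ := Q) (X := fun x : ℝ => x) (by fun_prop) measurable_snd.aemeasurable
    rw [hs, variance_fun_id_gaussianReal] at this
    exact this.symm
  have cv : covariance (fun z : ℝ × ℝ => z.1) (fun z => z.2) Q = 0 :=
    hind.covariance_eq_zero lf.memLp_two ls.memLp_two
  have mf : MemLp (fun z : ℝ × ℝ => z.1) 2 Q := lf.memLp_two
  have ms : MemLp (fun z : ℝ × ℝ => z.2) 2 Q := ls.memLp_two
  refine map_prodMk_eq_of_hasGaussianLaw h hT ?_ ?_ ?_ ?_ ?_
  · rw [hX, if0]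
  · rw [hY, integral_add (lf.integrable.const_mul _) (ls.integrable.const_mul _),
      integral_const_mul, integral_const_mul, if0, is0]
    simp
  · rw [vX, vf]
  · rw [vY, variance_fun_add (mf.const_mul _) (ms.const_mul _), variance_const_mul,
      variance_const_mul, covariance_const_mul_left, covariance_const_mul_right, vf, vs, cv,
      Real.sq_sqrt (by linarith)]
    ring
  · have := covariance_add_right mf (mf.const_mul r) (ms.const_mul √(1 - r ^ 2))
    rw [covariance_const_mul_right, covariance_const_mul_right, cv, covariance_self (by fun_prop),
      vf] at this
    rw [c]
    refine (Eq.trans ?_ this.symm)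
    ring

lemma measurePreserving_fst_gaussianPair (r : ℝ) :
    MeasurePreserving Prod.fst (gaussianPair r) (gaussianReal 0 1) := by
  refine ⟨measurable_fst, ?_⟩
  rw [gaussianPair, Measure.map_map (by fun_prop) (by fun_prop)]
  change Measure.map Prod.fst _ = _
  simp

lemma measurePreserving_snd_gaussianPair {r : ℝ} (hr : r ^ 2 ≤ 1) :
    MeasurePreserving Prod.snd (gaussianPair r) (gaussianReal 0 1) := by
  refine ⟨measurable_snd, ?_⟩
  set Q := (gaussianReal 0 1).prod (gaussianReal 0 1) with hQ
  have hf : Q.map Prod.fst = gaussianReal 0 1 := by simp [hQ]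
  have hs : Q.map Prod.snd = gaussianReal 0 1 := by simp [hQ]
  have hind : IndepFun (Prod.fst : ℝ × ℝ → ℝ) Prod.snd Q :=
    indepFun_prod (X := id) (Y := id) measurable_id measurable_id
  have h1 : Q.map (fun z => r * z.1) = gaussianReal 0 (.mk (r ^ 2) (sq_nonneg r)) := by
    have := gaussianReal_map_const_mul (μ := 0) (v := 1) r
    rw [← hf, Measure.map_map (by fun_prop) (by fun_prop)] at this
    simpa [Function.comp_def] using this
  have h2 : Q.map (fun z => √(1 - r ^ 2) * z.2) = gaussianReal 0
      (.mk (√(1 - r ^ 2) ^ 2) (sq_nonneg _)) := by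
    have := gaussianReal_map_const_mul (μ := 0) (v := 1) √(1 - r ^ 2)
    rw [← hs, Measure.map_map (by fun_prop) (by fun_prop)] at this
    simpa [Function.comp_def] using this
  have h3 := gaussianReal_add_gaussianReal_of_indepFun
    (hind.comp (φ := fun x => r * x) (ψ := fun x => √(1 - r ^ 2) * x) (by fun_prop) (by fun_prop))
    h1 h2
  rw [gaussianPair, Measure.map_map (by fun_prop) (by fun_prop)]
  refine Eq.trans h3 ?_
  congr 1
  · simp
  · ext
    simp [Real.sq_sqrt (show 0 ≤ 1 - r ^ 2 by linarith)]

end GaussBahadur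
-- Hermite polynomials: orthogonality for a pair, and completeness
namespace GaussBahadur

open Polynomial

lemma integral_comp_of_measurePreserving {α β : Type*} [MeasurableSpace α] [MeasurableSpace β]
    {μ : Measure α} {ν : Measure β} {φ : α → β} (hφ : MeasurePreserving φ μ ν) {u : β → ℝ}
    (hu : AEStronglyMeasurable u ν) : ∫ x, u (φ x) ∂μ = ∫ y, u y ∂ν := by
  rw [← hφ.map_eq] at hu ⊢
  exact (integral_map hφ.measurable.aemeasurable hu).symm

lemma memLp_fst_gaussianPair (r : ℝ) (p : ℝ[X]) :
    MemLp (fun z : ℝ × ℝ => p.eval z.1) 2 (gaussianPair r) :=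
  (memLp_polynomial_gaussian p).comp_measurePreserving (measurePreserving_fst_gaussianPair r)

lemma memLp_snd_gaussianPair {r : ℝ} (hr : r ^ 2 ≤ 1) (p : ℝ[X]) :
    MemLp (fun z : ℝ × ℝ => p.eval z.2) 2 (gaussianPair r) :=
  (memLp_polynomial_gaussian p).comp_measurePreserving (measurePreserving_snd_gaussianPair hr)

lemma integrable_mul_gaussianPair {r : ℝ} (hr : r ^ 2 ≤ 1) (p q : ℝ[X]) :
    Integrable (fun z : ℝ × ℝ => p.eval z.1 * q.eval z.2) (gaussianPair r) :=
  (memLp_fst_gaussianPair r p).integrable_mul (memLp_snd_gaussianPair hr q)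

/-- Gaussian integration by parts in the first variable of a Gaussian pair. -/
lemma integral_stein_gaussianPair {r : ℝ} (hr : r ^ 2 ≤ 1) (p q : ℝ[X]) :
    ∫ z, (X * p - derivative p).eval z.1 * q.eval z.2 ∂(gaussianPair r)
      = r * ∫ z, p.eval z.1 * (derivative q).eval z.2 ∂(gaussianPair r) := by
  have hI := integrable_mul_gaussianPair hr (X * p - derivative p) q
  have hJ := (integrable_mul_gaussianPair hr p (derivative q)).const_mul r
  rw [← integral_const_mul, ← sub_eq_zero, ← integral_sub hI hJ]
  have hK := hI.sub hJ
  rw [gaussianPair] at hK ⊢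
  have hm : Measurable (fun z : ℝ × ℝ => (z.1, r * z.1 + √(1 - r ^ 2) * z.2)) := by fun_prop
  rw [integral_map hm.aemeasurable (by fun_prop)]
  rw [integrable_map_measure (by fun_prop) hm.aemeasurable] at hK
  -- With the independent coordinate y fixed, this is the one-variable identity for x ↦ p(x) q(rx +
  -- √(1 - r²) y); the chain rule produces the factor r.
  refine (integral_prod_symm _ hK).trans ?_
  refine integral_eq_zero_of_ae (ae_of_all _ fun y => ?_)
  have h := integral_stein (p * q.comp (C r * X + C (√(1 - r ^ 2) * y)))
  refine Eq.trans (integral_congr_ae (ae_of_all _ fun x => ?_)) h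
  simp [derivative_comp]
  ring

/-- The probabilists' Hermite polynomials with real coefficients. -/
noncomputable def hermiteReal (n : ℕ) : ℝ[X] := (hermite n).map (Int.castRingHom ℝ)

lemma eval_hermiteReal (n : ℕ) (x : ℝ) : (hermiteReal n).eval x = aeval x (hermite n) := by
  rw [hermiteReal, eval_map, aeval_def]
  rfl

lemma hermiteReal_zero : hermiteReal 0 = 1 := by simp [hermiteReal]

lemma hermiteReal_succ (n : ℕ) :
    hermiteReal (n + 1) = X * hermiteReal n - derivative (hermiteReal n) := by
  simp [hermiteReal, hermite_succ, derivative_map]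

lemma derivative_hermiteReal_succ (n : ℕ) :
    derivative (hermiteReal (n + 1)) = (n + 1 : ℝ[X]) * hermiteReal n := by
  induction n with
  | zero => simp [hermiteReal_succ, hermiteReal_zero]
  | succ n ih =>
    have h : derivative (derivative (hermiteReal (n + 1)))
        = (n + 1 : ℝ[X]) * derivative (hermiteReal n) := by
      rw [ih]; simp [derivative_mul]
    rw [hermiteReal_succ (n + 1), derivative_sub, derivative_mul, h, ih, hermiteReal_succ n]
    simp
    ring

lemma natDegree_hermiteReal (n : ℕ) : (hermiteReal n).natDegree = n := by
  rw [hermiteReal, (hermite_monic n).natDegree_map, natDegree_hermite]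

lemma monic_hermiteReal (n : ℕ) : (hermiteReal n).Monic := (hermite_monic n).map _

/-- One integration by parts sends the degrees (j+1, m+1) to (j, m) with factor r(m+1), since the
derivative of H_{m+1} is (m+1)H_m. Unequal degrees end in the integral of a derivative of a constant
or of a positive-degree Hermite polynomial. -/
lemma integral_hermiteReal_gaussianPair {r : ℝ} (hr : r ^ 2 ≤ 1) (j m : ℕ) :
    ∫ z, (hermiteReal j).eval z.1 * (hermiteReal m).eval z.2 ∂(gaussianPair r)
      = if j = m then (j.factorial : ℝ) * r ^ j else 0 := by
  induction j generalizing m with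
  | zero =>
    have h := integral_comp_of_measurePreserving (measurePreserving_snd_gaussianPair hr)
      (u := fun x => (hermiteReal m).eval x) (by fun_prop)
    simp only [hermiteReal_zero, eval_one, one_mul]
    rw [h]
    cases m with
    | zero => simp [hermiteReal_zero]
    | succ m => rw [hermiteReal_succ, integral_stein]; simp
  | succ j ih =>
    rw [hermiteReal_succ, integral_stein_gaussianPair hr]
    cases m with
    | zero => simp [hermiteReal_zero]
    | succ m =>
      have : ∀ z : ℝ × ℝ, (hermiteReal j).eval z.1 * (derivative (hermiteReal (m + 1))).eval z.2
          = (m + 1) * ((hermiteReal j).eval z.1 * (hermiteReal m).eval z.2) := by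
        intro z
        rw [derivative_hermiteReal_succ]
        simp
        ring
      simp_rw [this]
      rw [integral_const_mul, ih]
      by_cases hjm : j = m
      · subst hjm
        simp [Nat.factorial_succ]
        ring
      · simp [hjm]

lemma integral_hermiteReal_mul (j m : ℕ) :
    ∫ x, (hermiteReal j).eval x * (hermiteReal m).eval x ∂(gaussianReal 0 1)
      = if j = m then (j.factorial : ℝ) else 0 := by
  -- At r = 1 the pair lives on the diagonal.
  have h := integral_hermiteReal_gaussianPair (r := 1) (by norm_num) j m
  rw [gaussianPair, integral_map (by fun_prop) (by fun_prop)] at h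
  simp only [one_pow, mul_one, sub_self, Real.sqrt_zero, zero_mul, add_zero, one_mul] at h
  rw [← h]
  have hf : MeasurePreserving Prod.fst ((gaussianReal 0 1).prod (gaussianReal 0 1))
    (gaussianReal 0 1) := measurePreserving_fst
  exact (integral_comp_of_measurePreserving hf (u := fun x => (hermiteReal j).eval x * (hermiteReal m).eval x)
    (by fun_prop)).symm

/-- A square-integrable function orthogonal to all monomials vanishes almost everywhere. -/
lemma ae_eq_zero_of_integral_mul_pow {f : ℝ → ℝ} (hf : MemLp f 2 (gaussianReal 0 1))
    (h : ∀ n : ℕ, ∫ x, f x * x ^ n ∂(gaussianReal 0 1) = 0) :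
    f =ᵐ[gaussianReal 0 1] 0 := by
  set γ := gaussianReal 0 1 with hγ
  have hfi : Integrable f γ := hf.integrable (by norm_num)
  -- Cauchy–Schwarz with Gaussian exponential moments: the domination that allows e^{itx} to be
  -- expanded termwise against f.
  have hexp : ∀ t : ℝ, Integrable (fun x => |f x| * Real.exp (|t| * |x|)) γ := by
    intro t
    refine MemLp.integrable_mul (p := 2) (q := 2) hf.abs ?_
    rw [memLp_two_iff_integrable_sq (by fun_prop)]
    have := integrable_exp_mul_abs (X := fun x : ℝ => x) (μ := γ) (t := 2 * |t|)
      (by rw [hγ]; exact integrable_exp_mul_gaussianReal _)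
      (by rw [hγ]; exact integrable_exp_mul_gaussianReal _)
    refine this.congr (ae_of_all _ fun x => ?_)
    simp only
    rw [← Real.exp_nat_mul]
    congr 1
    push_cast
    ring
  have hchar : ∀ t : ℝ, ∫ x, (f x : ℂ) * Complex.exp (t * x * Complex.I) ∂γ = 0 := by
    intro t
    have hs : HasSum (fun n : ℕ => ∫ x, (f x : ℂ) * ((t * x * Complex.I) ^ n / n.factorial) ∂γ)
        (∫ x, (f x : ℂ) * Complex.exp (t * x * Complex.I) ∂γ) := by
      refine hasSum_integral_of_dominated_convergence
        (fun n x => |f x| * ((|t| * |x|) ^ n / n.factorial)) ?_ ?_ ?_ ?_ ?_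
      · intro n
        exact (Complex.continuous_ofReal.comp_aestronglyMeasurable hf.1).mul
          (by fun_prop)
      · intro n
        refine ae_of_all _ fun x => ?_
        simp
      · refine ae_of_all _ fun x => ?_
        exact (Real.summable_pow_div_factorial _).mul_left _
      · refine (hexp t).congr (ae_of_all _ fun x => ?_)
        simp only
        rw [tsum_mul_left, Real.exp_eq_exp_ℝ, NormedSpace.exp_eq_tsum_div]
      · refine ae_of_all _ fun x => ?_
        refine HasSum.mul_left _ ?_
        rw [Complex.exp_eq_exp_ℂ]
        exact NormedSpace.expSeries_div_hasSum_exp _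
    have h0 : ∀ n : ℕ, ∫ x, (f x : ℂ) * ((t * x * Complex.I) ^ n / n.factorial) ∂γ = 0 := by
      intro n
      have : ∀ x : ℝ, (f x : ℂ) * ((t * x * Complex.I) ^ n / n.factorial)
          = ((t * Complex.I) ^ n / n.factorial) * ((f x * x ^ n : ℝ) : ℂ) := by
        intro x
        push_cast
        ring
      simp_rw [this]
      rw [integral_const_mul, integral_complex_ofReal, h n]
      simp
    simp_rw [h0] at hs
    exact hs.unique hasSum_zero
  obtain ⟨f', hf'm, hff'⟩ := hf.1
  have hf'i : Integrable f' γ := hfi.congr hff'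
  have hneg : Integrable (fun x => -f' x) γ := hf'i.neg
  -- The positive and negative parts of f define two finite measures; the vanishing Fourier
  -- transform of f says that their characteristic functions agree.
  have key : γ.withDensity (fun x => ENNReal.ofReal (f' x))
      = γ.withDensity (fun x => ENNReal.ofReal (-f' x)) := by
    have : IsFiniteMeasure (γ.withDensity (fun x => ENNReal.ofReal (f' x))) :=
      isFiniteMeasure_withDensity_ofReal hf'i.2
    have : IsFiniteMeasure (γ.withDensity (fun x => ENNReal.ofReal (-f' x))) :=
      isFiniteMeasure_withDensity_ofReal hneg.2
    refine Measure.ext_of_charFun ?_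
    ext t
    rw [charFun_apply_real, charFun_apply_real]
    have hm : Measurable f' := hf'm.measurable
    rw [integral_withDensity_eq_integral_toReal_smul (by fun_prop)
        (ae_of_all _ fun x => ENNReal.ofReal_lt_top),
      integral_withDensity_eq_integral_toReal_smul (by fun_prop)
        (ae_of_all _ fun x => ENNReal.ofReal_lt_top), ← sub_eq_zero]
    have hb : ∀ {u : ℝ → ℝ}, Integrable u γ → Measurable u →
        Integrable (fun x => (ENNReal.ofReal (u x)).toReal • Complex.exp (t * x * Complex.I)) γ := by
      intro u hu hum
      refine hu.norm.mono' (by fun_prop) (ae_of_all _ fun x => ?_)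
      rw [norm_smul, Complex.norm_exp]
      simp [ENNReal.toReal_ofReal']
      rcases le_total 0 (u x) with h | h
      · simp [h, abs_of_nonneg h]
      · simp [h]
    rw [← integral_sub (hb hf'i hm) (hb hneg hm.neg), ← hchar t]
    refine integral_congr_ae (hff'.mono fun x hx => ?_)
    simp only [hx, ENNReal.toReal_ofReal']
    rw [← sub_smul, Complex.real_smul]
    congr 2
    exact max_zero_sub_max_neg_zero_eq_self _
  rw [withDensity_eq_iff (by fun_prop) (by fun_prop) (by
    exact (hf'i.lintegral_lt_top).ne)] at key
  filter_upwards [key, hff'] with x hx hfx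
  rw [hfx]
  simp only [Pi.zero_apply]
  rcases lt_trichotomy (f' x) 0 with h1 | h1 | h1
  · rw [ENNReal.ofReal_of_nonpos h1.le] at hx
    have := ENNReal.ofReal_eq_zero.1 hx.symm
    linarith
  · exact h1
  · rw [ENNReal.ofReal_of_nonpos (p := -f' x) (by linarith)] at hx
    have := ENNReal.ofReal_eq_zero.1 hx
    linarith

end GaussBahadur
-- Hermite expansion and the covariance inequality
namespace GaussBahadur

/-- The normalised Hermite polynomial, as an element of `L²` of the standard Gaussian law. -/
noncomputable def hermiteLp (j : ℕ) : Lp ℝ 2 (gaussianReal 0 1) :=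
  (√(j.factorial : ℝ))⁻¹ • (memLp_polynomial_gaussian (hermiteReal j)).toLp

lemma inner_toLp {Ω : Type*} [MeasurableSpace Ω] {μ : Measure Ω} {u v : Ω → ℝ}
    (hu : MemLp u 2 μ) (hv : MemLp v 2 μ) :
    inner ℝ hu.toLp hv.toLp = ∫ x, u x * v x ∂μ := by
  rw [L2.inner_def]
  refine integral_congr_ae ?_
  filter_upwards [hu.coeFn_toLp, hv.coeFn_toLp] with x hx hy
  rw [hx, hy]
  simp [mul_comm]

lemma orthonormal_hermiteLp : Orthonormal ℝ hermiteLp := by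
  rw [orthonormal_iff_ite]
  intro i j
  rw [hermiteLp, hermiteLp, real_inner_smul_left, real_inner_smul_right, inner_toLp,
    integral_hermiteReal_mul]
  split_ifs with h
  · subst h
    have : (0 : ℝ) < i.factorial := by positivity
    rw [← mul_assoc, ← mul_inv, Real.mul_self_sqrt this.le, inv_mul_cancel₀ this.ne']
  · simp

/-- The Hermite polynomials as a polynomial sequence. -/
noncomputable def hermiteSequence : Polynomial.Sequence ℝ where
  elems' := hermiteReal
  degree_eq' n := by
    rw [Polynomial.degree_eq_natDegree (monic_hermiteReal n).ne_zero, natDegree_hermiteReal]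

lemma integral_mul_polynomial_eq_zero {f : ℝ → ℝ} (hf : MemLp f 2 (gaussianReal 0 1))
    (h : ∀ j, ∫ x, f x * (hermiteReal j).eval x ∂(gaussianReal 0 1) = 0) (p : Polynomial ℝ) :
    ∫ x, f x * p.eval x ∂(gaussianReal 0 1) = 0 := by
  have hp : p ∈ Submodule.span ℝ (Set.range hermiteSequence) := by
    rw [hermiteSequence.span fun i => by
      rw [show hermiteSequence i = hermiteReal i from rfl, (monic_hermiteReal i).leadingCoeff]
      exact isUnit_one]
    trivial
  induction hp using Submodule.span_induction with
  | mem p hp => obtain ⟨j, rfl⟩ := hp; exact h j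
  | zero => simp
  | add p q _ _ hp hq =>
    simp only [Polynomial.eval_add, mul_add]
    have h := integral_add (hf.integrable_mul (memLp_polynomial_gaussian p))
      (hf.integrable_mul (memLp_polynomial_gaussian q))
    simp only [Pi.mul_apply] at h
    rw [h, hp, hq, add_zero]
  | smul a p _ hp =>
    simp only [Polynomial.eval_smul, smul_eq_mul, mul_left_comm (f _) a]
    rw [integral_const_mul, hp, mul_zero]

lemma orthogonal_span_hermiteLp : (Submodule.span ℝ (Set.range hermiteLp))ᗮ = ⊥ := by
  rw [Submodule.eq_bot_iff]
  intro F hF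
  rw [Submodule.mem_orthogonal'] at hF
  have hM := Lp.memLp F
  have hz : ∀ j, ∫ x, F x * (hermiteReal j).eval x ∂(gaussianReal 0 1) = 0 := by
    intro j
    have h := hF _ (Submodule.subset_span ⟨j, rfl⟩)
    rw [hermiteLp, real_inner_smul_right, ← Lp.toLp_coeFn F hM, inner_toLp] at h
    have : (√(j.factorial : ℝ))⁻¹ ≠ 0 := by positivity
    exact (mul_eq_zero.1 h).resolve_left this
  have h0 := ae_eq_zero_of_integral_mul_pow hM fun n => by
    simpa using integral_mul_polynomial_eq_zero hM hz (Polynomial.X ^ n)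
  exact (Lp.eq_zero_iff_ae_eq_zero).2 h0

/-- The normalised Hermite polynomials form a Hilbert basis of `L²` of the Gaussian law. -/
noncomputable def hermiteBasis : HilbertBasis ℕ ℝ (Lp ℝ 2 (gaussianReal 0 1)) :=
  HilbertBasis.mkOfOrthogonalEqBot orthonormal_hermiteLp orthogonal_span_hermiteLp

lemma hermiteBasis_apply (j : ℕ) : hermiteBasis j = hermiteLp j := by
  simp [hermiteBasis]

/-- The covariance inequality for a function of a Gaussian pair whose Hermite rank is at
least `m`. -/
theorem abs_integral_gaussianPair_le {r : ℝ} (hr : r ^ 2 ≤ 1) {h : ℝ → ℝ}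
    (hh : MemLp h 2 (gaussianReal 0 1)) (m : ℕ)
    (hc : ∀ j < m, ∫ x, h x * (hermiteReal j).eval x ∂(gaussianReal 0 1) = 0) :
    |∫ z, h z.1 * h z.2 ∂(gaussianPair r)| ≤ |r| ^ m * ∫ x, h x ^ 2 ∂(gaussianReal 0 1) := by
  have hf := measurePreserving_fst_gaussianPair r
  have hs := measurePreserving_snd_gaussianPair hr
  -- `A` and `B` embed L² of the marginal isometrically as functions of the first and second
  -- coordinate; the integral to bound is the inner product of `A F` and `B F`.
  let A := Lp.compMeasurePreservingₗᵢ (E := ℝ) (p := 2) ℝ Prod.fst hf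
  let B := Lp.compMeasurePreservingₗᵢ (E := ℝ) (p := 2) ℝ Prod.snd hs
  set F := hh.toLp with hF
  have hAB : ∀ {u v : ℝ → ℝ} (hu : MemLp u 2 (gaussianReal 0 1))
      (hv : MemLp v 2 (gaussianReal 0 1)),
      inner ℝ (A hu.toLp) (B hv.toLp) = ∫ z, u z.1 * v z.2 ∂(gaussianPair r) := by
    intro u v hu hv
    exact inner_toLp (hu.comp_measurePreserving hf) (hv.comp_measurePreserving hs)
  let c : ℕ → ℝ := fun j => hermiteBasis.repr F j
  have hsum : HasSum (fun j => c j • hermiteLp j) F := by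
    simpa [hermiteBasis_apply] using hermiteBasis.hasSum_repr F
  have hbase : ∀ i j, inner ℝ (A (hermiteLp i)) (B (hermiteLp j)) = if i = j then r ^ i else 0 := by
    intro i j
    rw [hermiteLp, hermiteLp, map_smul, map_smul, real_inner_smul_left, real_inner_smul_right, hAB,
      integral_hermiteReal_gaussianPair hr]
    split_ifs with h
    · subst h
      have : (0 : ℝ) < i.factorial := by positivity
      rw [← mul_assoc, ← mul_inv, Real.mul_self_sqrt this.le, ← mul_assoc,
        inv_mul_cancel₀ this.ne', one_mul]
    · simp
  have h1 : ∀ j, inner ℝ (A F) (B (hermiteLp j)) = c j * r ^ j := by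
    intro j
    have h := ((innerSL ℝ (B (hermiteLp j))).comp A.toContinuousLinearMap).hasSum hsum
    have h' := h.unique (hasSum_single j fun i hij => ?_)
    · rw [real_inner_comm]
      refine Eq.trans h' ?_
      simp [real_inner_comm, hbase]
    · simp [real_inner_comm, hbase, hij]
  have h2 : HasSum (fun j => c j ^ 2 * r ^ j) (inner ℝ (A F) (B F)) := by
    have h := ((innerSL ℝ (A F)).comp B.toContinuousLinearMap).hasSum hsum
    refine Eq.mp (congrArg (fun u => HasSum u _) (funext fun j => ?_)) h
    simp [h1]
    ring
  have h3 : HasSum (fun j => c j ^ 2) (∫ x, h x ^ 2 ∂(gaussianReal 0 1)) := by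
    have h4 := hermiteBasis.hasSum_inner_mul_inner F F
    rw [hF, inner_toLp] at h4
    simp only [pow_two]
    refine Eq.mp (congrArg (fun u => HasSum u _) (funext fun j => ?_)) h4
    simp only [c, hermiteBasis.repr_apply_apply, hF]
    rw [real_inner_comm]
  have hc0 : ∀ j < m, c j = 0 := by
    intro j hj
    simp only [c, hermiteBasis.repr_apply_apply, hermiteBasis_apply]
    rw [hermiteLp, real_inner_smul_left, real_inner_comm, inner_toLp, hc j hj, mul_zero]
  have hr1 : |r| ≤ 1 := by
    rw [← Real.sqrt_sq_eq_abs]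
    exact Real.sqrt_le_one.2 hr
  -- Compare Σ c_j² r^j with Parseval's Σ c_j²: terms below m vanish, and |r|^j ≤ |r|^m for the
  -- others.
  rw [← hAB hh hh, ← Real.norm_eq_abs, ← h2.tsum_eq, ← h3.tsum_eq, ← tsum_mul_left]
  refine tsum_of_norm_bounded ((h3.summable.mul_left _).hasSum) fun j => ?_
  rcases lt_or_ge j m with hj | hj
  · simp [hc0 j hj]
  · rw [norm_mul, norm_pow, norm_pow, Real.norm_eq_abs, Real.norm_eq_abs, sq_abs, mul_comm]
    exact mul_le_mul_of_nonneg_right (pow_le_pow_of_le_one (abs_nonneg r) hr1 hj) (sq_nonneg _)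

end GaussBahadur
-- Second moments of partial sums and centred indicators
namespace GaussBahadur

/-- In each row i, the indices j ≤ i and j > i each map injectively to the distance |i - j| < n;
hence the factor 2. -/
lemma sum_sum_dist_le (a : ℕ → ℕ → ℝ) (b : ℕ → ℝ) (hb : ∀ k, 0 ≤ b k)
    (h1 : ∀ i k, a i (i + k) ≤ b k) (h2 : ∀ i k, a (i + k) i ≤ b k) (n : ℕ) :
    ∑ i ∈ Finset.range n, ∑ j ∈ Finset.range n, a i j
      ≤ 2 * n * ∑ k ∈ Finset.range n, b k := by
  have key : ∀ i ∈ Finset.range n,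
      ∑ j ∈ Finset.range n, a i j ≤ 2 * ∑ k ∈ Finset.range n, b k := by
    intro i hi
    rw [Finset.mem_range] at hi
    rw [← Finset.sum_filter_add_sum_filter_not _ (fun j => j ≤ i), two_mul]
    have hle : ∀ (s : Finset ℕ) (φ : ℕ → ℕ), Set.InjOn φ s → (∀ j ∈ s, φ j < n) →
        (∀ j ∈ s, a i j ≤ b (φ j)) → ∑ j ∈ s, a i j ≤ ∑ k ∈ Finset.range n, b k := by
      intro s φ hinj hlt hab
      calc ∑ j ∈ s, a i j ≤ ∑ j ∈ s, b (φ j) := Finset.sum_le_sum hab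
        _ = ∑ k ∈ s.image φ, b k := (Finset.sum_image hinj).symm
        _ ≤ _ := by
          refine Finset.sum_le_sum_of_subset_of_nonneg ?_ fun k _ _ => hb k
          intro k hk
          obtain ⟨j, hj, rfl⟩ := Finset.mem_image.1 hk
          exact Finset.mem_range.2 (hlt j hj)
    refine add_le_add (hle _ (fun j => i - j) ?_ ?_ ?_) (hle _ (fun j => j - i) ?_ ?_ ?_)
    · intro x hx y hy hxy
      simp at hx hy hxy
      omega
    · intro j _
      exact (Nat.sub_le i j).trans_lt hi
    · intro j hj
      simp at hj
      have := h2 j (i - j)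
      rwa [Nat.add_sub_cancel' hj.2] at this
    · intro x hx y hy hxy
      simp at hx hy hxy
      omega
    · intro j hj
      simp at hj ⊢
      omega
    · intro j hj
      simp at hj
      have := h1 i (j - i)
      rwa [Nat.add_sub_cancel' hj.2.le] at this
  calc _ ≤ ∑ i ∈ Finset.range n, 2 * ∑ k ∈ Finset.range n, b k := Finset.sum_le_sum key
    _ = _ := by simp; ring

section StationaryProcess

variable {Ω : Type*} [MeasurableSpace Ω] {P : Measure Ω}
  {Y : ℕ → Ω → ℝ} {ρ : ℕ → ℝ}

lemma IsStationaryGaussian.map_eq (hY : IsStationaryGaussian P Y ρ) (i : ℕ) :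
    P.map (Y i) = gaussianReal 0 1 := by
  rw [(hY.gaussian.hasGaussianLaw_eval i).map_eq_gaussianReal, hY.mean_zero, hY.variance_one]
  simp

lemma IsStationaryGaussian.sq_le_one (hY : IsStationaryGaussian P Y ρ) (k : ℕ) :
    ρ k ^ 2 ≤ 1 := by
  have := hY.gaussian.isProbabilityMeasure
  have m0 : MemLp (Y 0) 2 P := (hY.gaussian.hasGaussianLaw_eval 0).memLp_two
  have mk : MemLp (Y k) 2 P := (hY.gaussian.hasGaussianLaw_eval k).memLp_two
  have hc := hY.cov_eq 0 k
  rw [zero_add] at hc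
  -- The variances of Y(0) ± Y(k) are 2 ± 2ρ(k).
  have h1 := variance_nonneg (fun ω => Y 0 ω + Y k ω) P
  have h2 := variance_nonneg (fun ω => Y 0 ω - Y k ω) P
  rw [variance_fun_add m0 mk, hY.variance_one, hY.variance_one, hc] at h1
  rw [variance_fun_sub m0 mk, hY.variance_one, hY.variance_one, hc] at h2
  nlinarith

lemma IsStationaryGaussian.abs_le_one (hY : IsStationaryGaussian P Y ρ) (k : ℕ) :
    |ρ k| ≤ 1 := by
  rw [← Real.sqrt_sq_eq_abs]
  exact Real.sqrt_le_one.2 (hY.sq_le_one k)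

lemma IsStationaryGaussian.memLp_comp (hY : IsStationaryGaussian P Y ρ) {h : ℝ → ℝ}
    (hh : MemLp h 2 (gaussianReal 0 1)) (i : ℕ) : MemLp (fun ω => h (Y i ω)) 2 P := by
  rw [← hY.map_eq i] at hh
  exact hh.comp_of_map (hY.gaussian.aemeasurable i)

lemma IsStationaryGaussian.abs_integral_le (hY : IsStationaryGaussian P Y ρ) {h : ℝ → ℝ}
    (hm : Measurable h) (hh : MemLp h 2 (gaussianReal 0 1)) (m : ℕ)
    (hc : ∀ j < m, hermiteCoeff h j = 0) (i k : ℕ) :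
    |∫ ω, h (Y i ω) * h (Y (i + k) ω) ∂P|
      ≤ |ρ k| ^ m * ∫ x, h x ^ 2 ∂(gaussianReal 0 1) := by
  have hlaw := map_prodMk_eq_gaussianPair
    (hY.gaussian.hasGaussianLaw_prodMk (s := i) (t := i + k)) (hY.mean_zero i)
    (hY.mean_zero (i + k)) (hY.variance_one i) (hY.variance_one (i + k)) (hY.cov_eq i k)
    (hY.sq_le_one k)
  have hint := integral_map (μ := P) (f := fun z : ℝ × ℝ => h z.1 * h z.2)
    ((hY.gaussian.aemeasurable i).prodMk (hY.gaussian.aemeasurable (i + k)))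
    (by fun_prop)
  rw [hlaw] at hint
  rw [← hint]
  refine abs_integral_gaussianPair_le (hY.sq_le_one k) hh m fun j hj => ?_
  refine Eq.trans ?_ (hc j hj)
  rw [hermiteCoeff]
  simp_rw [eval_hermiteReal]

lemma IsStationaryGaussian.integral_sq_sum_le (hY : IsStationaryGaussian P Y ρ) {h : ℝ → ℝ}
    (hm : Measurable h) (hh : MemLp h 2 (gaussianReal 0 1)) (m : ℕ)
    (hc : ∀ j < m, hermiteCoeff h j = 0) (n : ℕ) :
    ∫ ω, (∑ i ∈ Finset.range n, h (Y i ω)) ^ 2 ∂P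
      ≤ 2 * n * (∑ k ∈ Finset.range n, |ρ k| ^ m) * ∫ x, h x ^ 2 ∂(gaussianReal 0 1) := by
  have hI : ∀ i j, Integrable (fun ω => h (Y i ω) * h (Y j ω)) P := fun i j =>
    (hY.memLp_comp hh i).integrable_mul (hY.memLp_comp hh j)
  simp_rw [pow_two (∑ i ∈ Finset.range n, h (Y i _)), Finset.sum_mul_sum]
  rw [integral_finsetSum _ fun i _ => integrable_finsetSum _ fun j _ => hI i j]
  simp_rw [integral_finsetSum _ fun j _ => hI _ j]
  have h0 : 0 ≤ ∫ x, h x ^ 2 ∂(gaussianReal 0 1) := integral_nonneg fun x => sq_nonneg _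
  have key := sum_sum_dist_le (fun i j => ∫ ω, h (Y i ω) * h (Y j ω) ∂P)
    (fun k => |ρ k| ^ m * ∫ x, h x ^ 2 ∂(gaussianReal 0 1)) (fun k => by positivity)
    (fun i k => (le_abs_self _).trans (hY.abs_integral_le hm hh m hc i k))
    (fun i k => by
      simp_rw [mul_comm (h (Y (i + k) _))]
      exact (le_abs_self _).trans (hY.abs_integral_le hm hh m hc i k)) n
  rw [← Finset.sum_mul, ← mul_assoc] at key
  exact key

/-- Markov's inequality for the squared sum; the source of both tightness and small increments. -/
lemma IsStationaryGaussian.measureReal_abs_sum_ge_le (hY : IsStationaryGaussian P Y ρ)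
    {h : ℝ → ℝ} (hm : Measurable h) (hh : MemLp h 2 (gaussianReal 0 1)) (m : ℕ)
    (hc : ∀ j < m, hermiteCoeff h j = 0) {n : ℕ} (hn : 0 < n) {t : ℝ} (ht : 0 < t) :
    P.real {ω | t ≤ |(∑ i ∈ Finset.range n, h (Y i ω)) / n|}
      ≤ 2 * ((∑ k ∈ Finset.range n, |ρ k| ^ m) / n) * (∫ x, h x ^ 2 ∂(gaussianReal 0 1))
        / t ^ 2 := by
  have hn' : (0 : ℝ) < n := by exact_mod_cast hn
  have hL : MemLp (fun ω => ∑ i ∈ Finset.range n, h (Y i ω)) 2 P :=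
    memLp_finsetSum _ fun i _ => hY.memLp_comp hh i
  have := hY.gaussian.isProbabilityMeasure
  have h1 := mul_meas_ge_le_integral_of_nonneg (μ := P)
    (f := fun ω => (∑ i ∈ Finset.range n, h (Y i ω)) ^ 2)
    (ae_of_all _ fun ω => sq_nonneg _) hL.integrable_sq ((t * n) ^ 2)
  have hset : {ω | t ≤ |(∑ i ∈ Finset.range n, h (Y i ω)) / n|}
      = {ω | (t * n) ^ 2 ≤ (∑ i ∈ Finset.range n, h (Y i ω)) ^ 2} := by
    ext ω
    simp only [Set.mem_ofPred_eq]
    rw [abs_div, abs_of_pos hn', le_div_iff₀ hn', sq_le_sq,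
      abs_of_pos (mul_pos ht hn')]
  rw [hset, le_div_iff₀ (by positivity)]
  have h2 := h1.trans (hY.integral_sq_sum_le hm hh m hc n)
  refine le_of_mul_le_mul_left ?_ (show (0 : ℝ) < (n : ℝ) ^ 2 by positivity)
  refine Eq.trans_le ?_ (h2.trans_eq ?_)
  · ring
  · field_simp

end StationaryProcess

section Indicator

variable {g : ℝ → ℝ}

lemma measurable_hInd (hg : Measurable g) (u : ℝ) : Measurable (hInd g u) := by
  unfold hInd
  exact (Measurable.ite (measurableSet_le hg measurable_const) measurable_const
    measurable_const).sub_const _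

lemma cdfG_eq (hg : Measurable g) (u : ℝ) :
    cdfG g u = (gaussianReal 0 1).real {t | g t ≤ u} := by
  have : IsProbabilityMeasure ((gaussianReal 0 1).map g) :=
    Measure.isProbabilityMeasure_map hg.aemeasurable
  rw [cdfG, cdf_eq_real, map_measureReal_apply hg measurableSet_Iic]
  rfl

lemma monotone_cdfG : Monotone (cdfG g) := monotone_cdf _

lemma cdfG_nonneg (u : ℝ) : 0 ≤ cdfG g u := cdf_nonneg _ _

lemma cdfG_le_one (u : ℝ) : cdfG g u ≤ 1 := cdf_le_one _ _

lemma abs_hInd_le (u t : ℝ) : |hInd g u t| ≤ 1 := by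
  have h0 := cdfG_nonneg (g := g) u
  have h1 := cdfG_le_one (g := g) u
  unfold hInd
  split_ifs <;> rw [abs_le] <;> constructor <;> linarith

lemma memLp_hInd (hg : Measurable g) (u : ℝ) : MemLp (hInd g u) 2 (gaussianReal 0 1) :=
  MemLp.of_bound (measurable_hInd hg u).aestronglyMeasurable 1
    (ae_of_all _ fun t => abs_hInd_le u t)

open Classical in
lemma integral_ite_le (hg : Measurable g) (u : ℝ) :
    ∫ t, (if g t ≤ u then (1 : ℝ) else 0) ∂(gaussianReal 0 1) = cdfG g u := by
  rw [cdfG_eq hg]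
  have : (fun t => if g t ≤ u then (1 : ℝ) else 0) = {t | g t ≤ u}.indicator fun _ => 1 := by
    ext t
    simp [Set.indicator]
  rw [this, integral_indicator_const _ (measurableSet_le hg measurable_const)]
  simp

open Classical in
lemma integrable_ite_le (hg : Measurable g) (u : ℝ) :
    Integrable (fun t => if g t ≤ u then (1 : ℝ) else 0) (gaussianReal 0 1) := by
  refine Integrable.of_bound (C := 1) (Measurable.ite (measurableSet_le hg measurable_const)
    measurable_const measurable_const).aestronglyMeasurable (ae_of_all _ fun t => ?_)
  split_ifs <;> simp

lemma hermiteCoeff_hInd_zero (hg : Measurable g) (u : ℝ) : hermiteCoeff (hInd g u) 0 = 0 := by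
  have : ∀ t, hInd g u t * Polynomial.aeval t (Polynomial.hermite 0)
      = (if g t ≤ u then (1 : ℝ) else 0) - cdfG g u := by
    intro t
    simp [hInd]
  rw [hermiteCoeff]
  simp_rw [this]
  rw [integral_sub (integrable_ite_le hg u) (integrable_const _), integral_ite_le hg]
  simp

lemma hermiteCoeff_hInd_sub (hg : Measurable g) (u v : ℝ) (j : ℕ) :
    hermiteCoeff (fun t => hInd g u t - hInd g v t) j
      = hermiteCoeff (hInd g u) j - hermiteCoeff (hInd g v) j := by
  have hI : ∀ u, Integrable
      (fun t => hInd g u t * Polynomial.aeval t (Polynomial.hermite j)) (gaussianReal 0 1) := by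
    intro u
    simp_rw [← eval_hermiteReal]
    exact (memLp_hInd hg u).integrable_mul (memLp_polynomial_gaussian _)
  unfold hermiteCoeff
  rw [← integral_sub (hI u) (hI v)]
  simp_rw [sub_mul]

lemma integral_sq_hInd_le (hg : Measurable g) (u : ℝ) :
    ∫ t, hInd g u t ^ 2 ∂(gaussianReal 0 1) ≤ 1 := by
  have h := integral_mono (μ := gaussianReal 0 1) (memLp_hInd hg u).integrable_sq
    (integrable_const 1) fun t => (sq_le_one_iff_abs_le_one _).2 (abs_hInd_le u t)
  simpa using h

open Classical in
-- For v ≤ u the difference is a centred indicator of an event of probability d = F(u) - F(v), with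
-- variance d - d².
lemma integral_sq_hInd_sub_le (hg : Measurable g) (u v : ℝ) :
    ∫ t, (hInd g u t - hInd g v t) ^ 2 ∂(gaussianReal 0 1) ≤ |cdfG g u - cdfG g v| := by
  wlog huv : v ≤ u generalizing u v
  · have := this v u (le_of_not_ge huv)
    rw [abs_sub_comm]
    refine Eq.trans_le ?_ this
    congr 1
    ext t
    ring
  have hsq : ∀ t, (hInd g u t - hInd g v t) ^ 2
      = (1 - 2 * (cdfG g u - cdfG g v)) *
          ((if g t ≤ u then (1 : ℝ) else 0) - (if g t ≤ v then (1 : ℝ) else 0))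
        + (cdfG g u - cdfG g v) ^ 2 := by
    intro t
    unfold hInd
    split_ifs with h1 h2 h2
    · ring
    · ring
    · exact absurd (h2.trans huv) h1
    · ring
  simp_rw [hsq]
  have hd : Integrable (fun t => (if g t ≤ u then (1 : ℝ) else 0) - if g t ≤ v then 1 else 0)
      (gaussianReal 0 1) := (integrable_ite_le hg u).sub (integrable_ite_le hg v)
  rw [integral_add (hd.const_mul _) (integrable_const _), integral_const_mul,
    integral_sub (integrable_ite_le hg u) (integrable_ite_le hg v), integral_ite_le hg,
    integral_ite_le hg, abs_of_nonneg (sub_nonneg.2 (monotone_cdfG huv))]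
  simp
  nlinarith [sq_nonneg (cdfG g u - cdfG g v)]

lemma sampleCdf_sub_cdfG (y : ℕ → ℝ) (u : ℝ) {n : ℕ} (hn : 0 < n) :
    (∑ i ∈ Finset.range n, hInd g u (y i)) / n
      = sampleCdf n (fun i => g (y i)) u - cdfG g u := by
  have hn' : (n : ℝ) ≠ 0 := by exact_mod_cast hn.ne'
  unfold hInd sampleCdf
  rw [Finset.sum_sub_distrib, Finset.sum_boole]
  simp
  field_simp

end Indicator

end GaussBahadur
-- Growth of the correlation sums and the rate
namespace GaussBahadur

lemma sum_succ_rpow_neg_le {β : ℝ} (h0 : 0 < β) (h1 : β < 1) (n : ℕ) :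
    ∑ k ∈ Finset.range n, ((k + 1 : ℕ) : ℝ) ^ (-β) ≤ (n : ℝ) ^ (1 - β) / (1 - β) := by
  have hb : 0 < 1 - β := by linarith
  induction n with
  | zero => simp [Real.zero_rpow hb.ne']
  | succ n ih =>
    rw [Finset.sum_range_succ]
    have hx : (0 : ℝ) < ((n + 1 : ℕ) : ℝ) := by positivity
    -- Bernoulli for the concave power 1 - β: (1 - 1/(n+1))^{1-β} ≤ 1 - (1-β)/(n+1), which is the
    -- induction step after scaling by (n+1)^{1-β}.
    have hber := rpow_one_add_le_one_add_mul_self (s := -(((n + 1 : ℕ) : ℝ)⁻¹)) (by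
      rw [neg_le_neg_iff]
      exact inv_le_one_of_one_le₀ (by simp)) hb.le (by linarith)
    have hn : (n : ℝ) = ((n + 1 : ℕ) : ℝ) * (1 + -(((n + 1 : ℕ) : ℝ)⁻¹)) := by
      field_simp
      push_cast
      ring
    have hnn : 0 ≤ 1 + -(((n + 1 : ℕ) : ℝ)⁻¹) := by
      have : ((n + 1 : ℕ) : ℝ)⁻¹ ≤ 1 := inv_le_one_of_one_le₀ (by simp)
      linarith
    have hpow : (n : ℝ) ^ (1 - β) ≤ ((n + 1 : ℕ) : ℝ) ^ (1 - β)
        - (1 - β) * ((n + 1 : ℕ) : ℝ) ^ (-β) := by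
      conv_lhs => rw [hn]
      rw [Real.mul_rpow hx.le hnn]
      refine (mul_le_mul_of_nonneg_left hber (Real.rpow_nonneg hx.le _)).trans_eq ?_
      rw [show -β = (1 - β) - 1 by ring, Real.rpow_sub_one hx.ne']
      field_simp
      ring
    have := (div_le_div_iff_of_pos_right hb).2 hpow
    rw [sub_div, mul_div_cancel_left₀ _ hb.ne'] at this
    linarith

/-- The k = 0 term is 0 by the convention 0^{-β} = 0, so shifting the index only adds a nonnegative
last term. -/
lemma sum_rpow_neg_le_sum_succ {β : ℝ} (h0 : 0 < β) (n : ℕ) :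
    ∑ k ∈ Finset.range n, (k : ℝ) ^ (-β) ≤ ∑ k ∈ Finset.range n, ((k + 1 : ℕ) : ℝ) ^ (-β) := by
  have h := Finset.sum_range_succ' (fun k : ℕ => (k : ℝ) ^ (-β)) n
  rw [Finset.sum_range_succ] at h
  simp only [Nat.cast_zero, Real.zero_rpow (neg_ne_zero.2 h0.ne'), add_zero] at h
  have : 0 ≤ (n : ℝ) ^ (-β) := Real.rpow_nonneg n.cast_nonneg _
  linarith

lemma rate_coe (α : ℝ) (m n : ℕ) : rate α (m : ℕ∞) n =
    if 1 < α * (m : ℝ) then (n : ℝ) ^ (-(1 / 2) : ℝ)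
    else if α * (m : ℝ) = 1 then (n : ℝ) ^ (-(1 / 2) : ℝ) * (Real.log n) ^ (1 / 2 : ℝ)
    else (n : ℝ) ^ (-(α * (m : ℝ) / 2)) := rfl

lemma one_le_log {n : ℕ} (hn : 3 ≤ n) : 1 ≤ Real.log n := by
  rw [Real.le_log_iff_exp_le (by positivity)]
  have : (3 : ℝ) ≤ n := by exact_mod_cast hn
  linarith [Real.exp_one_lt_d9]

lemma rate_pos (α : ℝ) (m : ℕ) {n : ℕ} (hn : 3 ≤ n) : 0 < rate α (m : ℕ∞) n := by
  have h := one_le_log hn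
  rw [rate_coe]
  split_ifs <;> positivity

/-- In each regime n R_n² bounds, up to a constant, the sum of k^{-αm} over k < n. Taking n ≥ 3
keeps log n ≥ 1. -/
lemma mul_rate_sq (α : ℝ) (m : ℕ) {n : ℕ} (hn : 3 ≤ n) : (n : ℝ) * rate α (m : ℕ∞) n ^ 2 =
    if 1 < α * (m : ℝ) then 1 else if α * (m : ℝ) = 1 then Real.log n
    else (n : ℝ) ^ (1 - α * (m : ℝ)) := by
  have h := one_le_log hn
  have hn' : (0 : ℝ) < n := by positivity
  have h1 : ∀ x : ℝ, ((n : ℝ) ^ x) ^ 2 = (n : ℝ) ^ (2 * x) := by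
    intro x
    rw [← Real.rpow_natCast, ← Real.rpow_mul hn'.le, mul_comm]
    norm_num
  have h2 : (n : ℝ) * ((n : ℝ) ^ (-(1 / 2) : ℝ)) ^ 2 = 1 := by
    rw [h1, show (2 : ℝ) * (-(1 / 2)) = -1 by norm_num, Real.rpow_neg_one,
      mul_inv_cancel₀ hn'.ne']
  rw [rate_coe]
  split_ifs
  · exact h2
  · rw [mul_pow, ← mul_assoc, h2, ← Real.sqrt_eq_rpow, Real.sq_sqrt (by linarith), one_mul]
  · rw [h1, show 2 * -(α * (m : ℝ) / 2) = -(α * m) by ring, sub_eq_add_neg, Real.rpow_add hn',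
      Real.rpow_one]

lemma one_le_mul_rate_sq (α : ℝ) (m : ℕ) {n : ℕ} (hn : 3 ≤ n) :
    1 ≤ (n : ℝ) * rate α (m : ℕ∞) n ^ 2 := by
  rw [mul_rate_sq α m hn]
  split_ifs with h1 h2
  · exact le_rfl
  · exact one_le_log hn
  · refine Real.one_le_rpow (by exact_mod_cast (by omega : 1 ≤ n)) ?_
    push Not at h1
    linarith

lemma exists_sum_rpow_neg_le {α : ℝ} (hα : 0 < α) {m : ℕ} (hm : 1 ≤ m) :
    ∃ C : ℝ, 0 ≤ C ∧ ∀ n : ℕ, 3 ≤ n → ∑ k ∈ Finset.range n, (k : ℝ) ^ (-(α * m))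
      ≤ C * ((n : ℝ) * rate α (m : ℕ∞) n ^ 2) := by
  have hβ : 0 < α * (m : ℝ) := by
    have : (0 : ℝ) < m := by exact_mod_cast hm
    positivity
  rcases lt_trichotomy (α * (m : ℝ)) 1 with h | h | h
  · refine ⟨(1 - α * m)⁻¹, inv_nonneg.2 (by linarith), fun n hn => ?_⟩
    rw [mul_rate_sq α m hn, if_neg (by linarith), if_neg h.ne]
    refine (sum_rpow_neg_le_sum_succ hβ n).trans ((sum_succ_rpow_neg_le hβ h n).trans_eq ?_)
    rw [div_eq_inv_mul]
  · refine ⟨2, by norm_num, fun n hn => ?_⟩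
    rw [mul_rate_sq α m hn, if_neg (by linarith), if_pos h]
    refine (sum_rpow_neg_le_sum_succ hβ n).trans ?_
    have hh := harmonic_le_one_add_log n
    have hl := one_le_log hn
    rw [h]
    simp only [Real.rpow_neg_one]
    simp only [harmonic, Rat.cast_sum, Rat.cast_inv, Rat.cast_natCast] at hh
    linarith
  · refine ⟨∑' k : ℕ, (k : ℝ) ^ (-(α * m)),
      tsum_nonneg fun k => Real.rpow_nonneg k.cast_nonneg _, fun n hn => ?_⟩
    rw [mul_rate_sq α m hn, if_pos h, mul_one]
    exact (Real.summable_nat_rpow.2 (by linarith)).sum_le_tsum _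
      fun k _ => Real.rpow_nonneg k.cast_nonneg _

lemma exists_sum_abs_pow_div_le {ρ : ℕ → ℝ} (h1 : ∀ k, |ρ k| ≤ 1) {α : ℝ} (hα : 0 < α)
    (hρ : Asymptotics.IsEquivalent atTop (fun k : ℕ => |ρ k|) (fun k : ℕ => (k : ℝ) ^ (-α)))
    {m : ℕ} (hm : 1 ≤ m) :
    ∃ C : ℝ, 0 ≤ C ∧ ∀ n : ℕ, 3 ≤ n →
      (∑ k ∈ Finset.range n, |ρ k| ^ m) / n ≤ C * rate α (m : ℕ∞) n ^ 2 := by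
  obtain ⟨D, hD⟩ := hρ.isBigO.bound
  obtain ⟨K, hK⟩ := eventually_atTop.1 hD
  obtain ⟨C, hC0, hC⟩ := exists_sum_rpow_neg_le hα hm
  -- The finitely many lags before the asymptotics apply contribute at most 1 each, hence at most K,
  -- absorbed through n R_n² ≥ 1.
  have hterm : ∀ k, |ρ k| ^ m ≤ (if k < K then (1 : ℝ) else 0)
      + |D| ^ m * (k : ℝ) ^ (-(α * m)) := by
    intro k
    have hk0 : (0 : ℝ) ≤ (k : ℝ) ^ (-α) := Real.rpow_nonneg k.cast_nonneg _
    have hp : (k : ℝ) ^ (-(α * m)) = ((k : ℝ) ^ (-α)) ^ m := by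
      rw [← Real.rpow_natCast, ← Real.rpow_mul k.cast_nonneg, neg_mul]
    rw [hp]
    split_ifs with hk
    · have := pow_le_one₀ (n := m) (abs_nonneg (ρ k)) (h1 k)
      have : 0 ≤ |D| ^ m * ((k : ℝ) ^ (-α)) ^ m := by positivity
      linarith
    · rw [zero_add, ← mul_pow]
      refine pow_le_pow_left₀ (abs_nonneg _) ?_ m
      have := hK k (not_lt.1 hk)
      rw [Real.norm_eq_abs, Real.norm_eq_abs, abs_abs, abs_of_nonneg hk0] at this
      exact this.trans (mul_le_mul_of_nonneg_right (le_abs_self D) hk0)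
  refine ⟨K + |D| ^ m * C, by positivity, fun n hn => ?_⟩
  have hn' : (0 : ℝ) < n := by positivity
  rw [div_le_iff₀ hn']
  have hs := Finset.sum_le_sum fun k (_ : k ∈ Finset.range n) => hterm k
  rw [Finset.sum_add_distrib, ← Finset.mul_sum] at hs
  have hK' : ∑ k ∈ Finset.range n, (if k < K then (1 : ℝ) else 0) ≤ K := by
    rw [Finset.sum_boole]
    have : (Finset.range n).filter (fun k => k < K) ⊆ Finset.range K := by
      intro k hk
      exact Finset.mem_range.2 (Finset.mem_filter.1 hk).2
    simpa using (Nat.cast_le (α := ℝ)).2 (Finset.card_le_card this)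
  have hone := one_le_mul_rate_sq α m hn
  have hK2 : (K : ℝ) ≤ K * ((n : ℝ) * rate α (m : ℕ∞) n ^ 2) :=
    le_mul_of_one_le_right K.cast_nonneg hone
  have hC2 := mul_le_mul_of_nonneg_left (hC n hn) (pow_nonneg (abs_nonneg D) m)
  calc _ ≤ _ := hs
    _ ≤ K * ((n : ℝ) * rate α (m : ℕ∞) n ^ 2)
        + |D| ^ m * (C * ((n : ℝ) * rate α (m : ℕ∞) n ^ 2)) := by linarith
    _ = _ := by ring

lemma tendsto_rate {α : ℝ} (hα : 0 < α) {m : ℕ} (hm : 1 ≤ m) :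
    Tendsto (rate α (m : ℕ∞)) atTop (𝓝 0) := by
  have hβ : 0 < α * (m : ℝ) := by
    have : (0 : ℝ) < m := by exact_mod_cast hm
    positivity
  have hneg : ∀ {x : ℝ}, 0 < x → Tendsto (fun n : ℕ => (n : ℝ) ^ (-x)) atTop (𝓝 0) := fun hx =>
    (tendsto_rpow_neg_atTop hx).comp tendsto_natCast_atTop_atTop
  have hfun : rate α (m : ℕ∞) = fun n => rate α (m : ℕ∞) n := rfl
  rw [hfun]
  simp_rw [rate_coe]
  split_ifs
  · exact hneg (by norm_num)
  · have h := ((isLittleO_log_rpow_rpow_atTop (1 / 2 : ℝ)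
      (show (0 : ℝ) < 1 / 2 by norm_num)).tendsto_div_nhds_zero).comp tendsto_natCast_atTop_atTop
    refine h.congr fun n => ?_
    simp only [Function.comp]
    rw [Real.rpow_neg n.cast_nonneg, div_eq_inv_mul]
  · exact hneg (by positivity)

/-- An infinite rank is replaced by any finite m with αm > 1: the rate is the same, and only
vanishing of coefficients below m is used later. -/
lemma exists_rate_eq {α : ℝ} (hα : 0 < α) {τ : ℕ∞} (hτ : 1 ≤ τ) :
    ∃ m : ℕ, 1 ≤ m ∧ (m : ℕ∞) ≤ τ ∧ rate α τ = rate α (m : ℕ∞) := by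
  induction τ using ENat.recTopCoe with
  | top =>
    obtain ⟨m, hm⟩ := exists_nat_gt (1 / α)
    have hm' : 1 < α * (m : ℝ) := by
      rw [div_lt_iff₀ hα] at hm
      linarith
    refine ⟨m, ?_, le_top, ?_⟩
    · by_contra h
      have : m = 0 := by omega
      subst this
      norm_num at hm'
    · ext n
      rw [rate_coe, if_pos hm']
      rfl
  | coe m => exact ⟨m, by exact_mod_cast hτ, le_rfl, rfl⟩

end GaussBahadur
-- Quantiles and the Bahadur argument
namespace GaussBahadur

section SampleQuantile

variable {n : ℕ} {y : ℕ → ℝ} {p x : ℝ}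

lemma sampleCdf_mono : Monotone (sampleCdf n y) := by
  intro a b hab
  unfold sampleCdf
  refine div_le_div_of_nonneg_right (Nat.cast_le.2 (Finset.card_le_card ?_)) n.cast_nonneg
  intro i hi
  rw [Finset.mem_filter] at hi ⊢
  exact ⟨hi.1, hi.2.trans hab⟩

lemma sampleQuantile_le (hp : 0 < p) (h : p ≤ sampleCdf n y x) : sampleQuantile n y p ≤ x := by
  -- The infimum is meaningful only for a set bounded below: p > 0 forces some sample point below z,
  -- hence z ≥ -Σ|y_i|.
  refine csInf_le ⟨-∑ i ∈ Finset.range n, |y i|, fun z hz => ?_⟩ h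
  have hz' : 0 < sampleCdf n y z := hp.trans_le hz
  have hne : (Finset.filter (fun i => y i ≤ z) (Finset.range n)).Nonempty := by
    by_contra hcon
    rw [Finset.not_nonempty_iff_eq_empty] at hcon
    have : sampleCdf n y z = 0 := by
      unfold sampleCdf
      convert zero_div (n : ℝ)
      simpa using hcon
    linarith
  obtain ⟨i, hi⟩ := hne
  rw [Finset.mem_filter] at hi
  have := Finset.single_le_sum (f := fun i => |y i|) (fun i _ => abs_nonneg _) hi.1
  have := neg_abs_le (y i)
  linarith

lemma le_sampleQuantile (hn : 0 < n) (hp : p ≤ 1) (h : sampleCdf n y x < p) :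
    x ≤ sampleQuantile n y p := by
  refine le_csInf ⟨∑ i ∈ Finset.range n, |y i|, ?_⟩ fun z hz => ?_
  · refine hp.trans_eq ?_
    unfold sampleCdf
    rw [Finset.filter_true_of_mem fun i hi => ?_]
    · rw [Finset.card_range, div_self]
      exact_mod_cast hn.ne'
    · exact (le_abs_self _).trans
        (Finset.single_le_sum (f := fun i => |y i|) (fun i _ => abs_nonneg _) hi)
  · by_contra hcon
    have := sampleCdf_mono (n := n) (y := y) (not_le.1 hcon).le
    exact absurd (hz.trans this) (not_le.2 h)

end SampleQuantile

lemma cdfG_xi_of_continuousAt {g : ℝ → ℝ} {p : ℝ} (hp0 : 0 < p) (hp1 : p < 1)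
    (hc : ContinuousAt (cdfG g) (xi g p)) : cdfG g (xi g p) = p := by
  have hbdd : BddBelow {x : ℝ | p ≤ cdfG g x} := by
    obtain ⟨b, hb⟩ := ((tendsto_cdf_atBot ((gaussianReal 0 1).map g)).eventually
      (gt_mem_nhds hp0)).exists
    refine ⟨b, fun x hx => ?_⟩
    by_contra hcon
    exact absurd (hx.trans (monotone_cdfG (not_le.1 hcon).le)) (not_le.2 hb)
  have hne : {x : ℝ | p ≤ cdfG g x}.Nonempty := by
    obtain ⟨b, hb⟩ := ((tendsto_cdf_atTop ((gaussianReal 0 1).map g)).eventually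
      (lt_mem_nhds hp1)).exists
    exact ⟨b, hb.le⟩
  refine le_antisymm ?_ ?_
  · by_contra hcon
    obtain ⟨δ, hδ, hball⟩ := Metric.eventually_nhds_iff.1 (hc.eventually (lt_mem_nhds (not_le.1 hcon)))
    have h := hball (y := xi g p - δ / 2) (by
      rw [Real.dist_eq, sub_sub_cancel_left, abs_neg, abs_of_pos (by positivity)]; linarith)
    have : xi g p ≤ xi g p - δ / 2 := csInf_le hbdd h.le
    linarith
  · by_contra hcon
    obtain ⟨δ, hδ, hball⟩ := Metric.eventually_nhds_iff.1 (hc.eventually (gt_mem_nhds (not_le.1 hcon)))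
    have h := hball (y := xi g p + δ / 2) (by
      rw [Real.dist_eq, add_sub_cancel_left, abs_of_pos (by positivity)]; linarith)
    have : xi g p + δ / 2 ≤ xi g p := by
      refine le_csInf hne fun z hz => ?_
      by_contra hcon'
      exact absurd (hz.trans (monotone_cdfG (not_le.1 hcon').le)) (not_le.2 h)
    linarith

lemma eventually_abs_increment_sub_le {F : ℝ → ℝ} {θ f : ℝ} (hF : HasDerivAt F f θ)
    {R : ℕ → ℝ} (hRpos : ∀ᶠ n in atTop, 0 < R n) (hR : Tendsto R atTop (𝓝 0)) (y : ℝ)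
    {δ : ℝ} (hδ : 0 < δ) :
    ∀ᶠ n in atTop, |F (θ + R n * y) - F θ - f * (R n * y)| ≤ δ * R n := by
  have ho := hasDerivAt_iff_isLittleO_nhds_zero.1 hF
  have hc : 0 < δ / (|y| + 1) := by positivity
  have hRy : Tendsto (fun n => R n * y) atTop (𝓝 0) := by simpa using hR.mul_const y
  filter_upwards [hRy.eventually (ho.def hc), hRpos] with n hn hpos
  rw [Real.norm_eq_abs, Real.norm_eq_abs, smul_eq_mul, abs_mul, abs_of_pos hpos, mul_comm _ f] at hn
  refine hn.trans ?_
  rw [div_mul_eq_mul_div, div_le_iff₀ (by positivity)]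
  have : 0 ≤ δ * R n := by positivity
  nlinarith

/-- Bahadur representation from tightness and asymptotic negligibility of local increments. -/
theorem tendstoInMeasure_bahadur {Ω : Type*} [MeasurableSpace Ω] (P : Measure Ω)
    [IsProbabilityMeasure P] {G : ℕ → Ω → ℝ → ℝ} {Q : ℕ → Ω → ℝ} {F : ℝ → ℝ} {θ f D : ℝ}
    {R : ℕ → ℝ} (hF : HasDerivAt F f θ) (hf : 0 < f)
    (hRpos : ∀ᶠ n in atTop, 0 < R n) (hR : Tendsto R atTop (𝓝 0))
    (hle : ∀ n ω x, F θ ≤ G n ω x → Q n ω ≤ x)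
    (hge : ∀ᶠ n in atTop, ∀ ω x, G n ω x < F θ → x ≤ Q n ω)
    (htight : ∀ᶠ n in atTop, ∀ K > 0, P.real {ω | K * R n ≤ |G n ω θ - F θ|} ≤ D / K ^ 2)
    (hincr : ∀ y, ∀ δ > 0, Tendsto (fun n => P.real {ω | δ * R n ≤
      |G n ω (θ + R n * y) - G n ω θ - (F (θ + R n * y) - F θ)|}) atTop (𝓝 0)) :
    TendstoInMeasure P (fun n ω => ((Q n ω - θ) - (F θ - G n ω θ) / f) / R n) atTop
      (fun _ => 0) := by
  rw [tendstoInMeasure_iff_measureReal_norm]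
  intro ε₀ hε₀
  rw [Metric.tendsto_nhds]
  intro η hη
  -- The grid locates the rescaled quantile within 2ε < ε₀.
  set ε := ε₀ / 3 with hε
  have hεpos : 0 < ε := by positivity
  obtain ⟨K, hKpos, hK⟩ : ∃ K : ℝ, 0 < K ∧ D / K ^ 2 < η / 2 := by
    have h : Tendsto (fun K : ℝ => D / K ^ 2) atTop (𝓝 0) :=
      tendsto_const_nhds.div_atTop (tendsto_pow_atTop two_ne_zero)
    exact ((eventually_gt_atTop 0).and (h.eventually (gt_mem_nhds (by positivity)))).exists
  -- Grid indices used below are within 2 of w/ε, where |w/ε| < K/(fε).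
  set N : ℤ := ⌈K / f / ε⌉ + 3 with hN
  set S := Finset.Icc (-N) N with hS
  -- Random increment and linearisation each cost δR_n; their total fεR_n/2 is less than the margin
  -- fεR_n gained by a shift of ε.
  set δ := f * ε / 4 with hδ
  have hδpos : 0 < δ := by positivity
  set B : ℕ → ℤ → Set Ω := fun n j => {ω | δ * R n ≤
      |G n ω (θ + R n * (j * ε)) - G n ω θ - (F (θ + R n * (j * ε)) - F θ)|} with hB
  have hsum : Tendsto (fun n => ∑ j ∈ S, P.real (B n j)) atTop (𝓝 0) := by
    simpa using tendsto_finsetSum S fun j _ => hincr (j * ε) δ hδpos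
  have hder : ∀ᶠ n in atTop, ∀ j ∈ S,
      |F (θ + R n * (j * ε)) - F θ - f * (R n * (j * ε))| ≤ δ * R n :=
    (Filter.eventually_all_finset S).2 fun j _ =>
      eventually_abs_increment_sub_le hF hRpos hR (j * ε) hδpos
  filter_upwards [hsum.eventually (gt_mem_nhds (half_pos hη)), hder, hRpos, hge, htight]
    with n hn hdern hpos hgen htn
  have hsub : {ω | ε₀ ≤ ‖((Q n ω - θ) - (F θ - G n ω θ) / f) / R n - 0‖}
      ⊆ {ω | K * R n ≤ |G n ω θ - F θ|} ∪ ⋃ j ∈ S, B n j := by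
    intro ω hω
    by_contra hcon
    simp only [Set.mem_union, Set.mem_iUnion, not_or, not_exists] at hcon
    obtain ⟨hc1, hc2⟩ := hcon
    simp only [Set.mem_ofPred_eq, not_le] at hc1
    set w := (F θ - G n ω θ) / f / R n with hw
    have hwe : F θ - G n ω θ = f * (R n * w) := by
      rw [hw]
      field_simp
    have hwM : |w| < K / f := by
      rw [hw, abs_div, abs_div, abs_of_pos hf, abs_of_pos hpos, abs_sub_comm,
        div_lt_iff₀ hpos, div_lt_iff₀ hf]
      refine hc1.trans_eq ?_
      field_simp
    have hwlt := (abs_lt.1 hwM)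
    have hwε : |w / ε| < K / f / ε := by
      rw [abs_div, abs_of_pos hεpos]
      exact div_lt_div_of_pos_right hwM hεpos
    have hwε' := abs_lt.1 hwε
    have hceil := Int.le_ceil (K / f / ε)
    have hgrid : ∀ j ∈ S, G n ω (θ + R n * (j * ε)) - F θ ≤ f * (R n * (j * ε - w)) + 2 * δ * R n ∧
        f * (R n * (j * ε - w)) - 2 * δ * R n ≤ G n ω (θ + R n * (j * ε)) - F θ := by
      intro j hj
      have h1 := hc2 j hj
      simp only [hB, Set.mem_ofPred_eq, not_le] at h1
      have h1' := abs_lt.1 h1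
      have h2' := abs_le.1 (hdern j hj)
      have h3 : f * (R n * (j * ε - w)) = f * (R n * (j * ε)) - (F θ - G n ω θ) := by
        rw [hwe]; ring
      constructor <;> linarith
    have hfR : 0 < f * (R n * ε) := by positivity
    -- A grid point in [w + ε, w + 2ε] has G_n ≥ F(θ); symmetrically, one in [w - 2ε, w - ε] has G_n
    -- < F(θ).
    have hup : (Q n ω - θ) / R n ≤ w + 2 * ε := by
      set j : ℤ := ⌈w / ε⌉ + 1 with hj
      have hj1 : w / ε + 1 ≤ j := by
        rw [hj]; push_cast; linarith [Int.le_ceil (w / ε)]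
      have hj2 : (j : ℝ) ≤ w / ε + 2 := by
        rw [hj]; push_cast; linarith [Int.ceil_lt_add_one (w / ε)]
      have hjS : j ∈ S := by
        rw [hS, Finset.mem_Icc, hN]
        constructor
        · have : (-((⌈K / f / ε⌉ + 3 : ℤ) : ℝ)) ≤ (j : ℝ) := by push_cast; linarith
          exact_mod_cast this
        · have : (j : ℝ) ≤ ((⌈K / f / ε⌉ + 3 : ℤ) : ℝ) := by push_cast; linarith
          exact_mod_cast this
      have hl : w + ε ≤ j * ε := by
        have := mul_le_mul_of_nonneg_right hj1 hεpos.le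
        rw [add_mul, div_mul_cancel₀ _ hεpos.ne'] at this
        linarith
      have hu : j * ε ≤ w + 2 * ε := by
        have := mul_le_mul_of_nonneg_right hj2 hεpos.le
        rw [add_mul, div_mul_cancel₀ _ hεpos.ne'] at this
        linarith
      have hg := (hgrid j hjS).2
      have hm : f * (R n * ε) ≤ f * (R n * (j * ε - w)) := by
        gcongr
        linarith
      have hq := hle n ω _ (show F θ ≤ G n ω (θ + R n * (j * ε)) by
        have : 2 * δ * R n = f * (R n * ε) / 2 := by rw [hδ]; ring
        linarith)
      refine le_trans ?_ hu
      rw [div_le_iff₀ hpos]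
      linarith
    have hlow : w - 2 * ε ≤ (Q n ω - θ) / R n := by
      set j : ℤ := ⌊w / ε⌋ - 1 with hj
      have hj1 : (j : ℝ) ≤ w / ε - 1 := by
        rw [hj]; push_cast; linarith [Int.floor_le (w / ε)]
      have hj2 : w / ε - 2 ≤ j := by
        rw [hj]; push_cast; linarith [Int.sub_one_lt_floor (w / ε)]
      have hjS : j ∈ S := by
        rw [hS, Finset.mem_Icc, hN]
        constructor
        · have : (-((⌈K / f / ε⌉ + 3 : ℤ) : ℝ)) ≤ (j : ℝ) := by push_cast; linarith
          exact_mod_cast this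
        · have : (j : ℝ) ≤ ((⌈K / f / ε⌉ + 3 : ℤ) : ℝ) := by push_cast; linarith
          exact_mod_cast this
      have hl : j * ε ≤ w - ε := by
        have := mul_le_mul_of_nonneg_right hj1 hεpos.le
        rw [sub_mul, div_mul_cancel₀ _ hεpos.ne'] at this
        linarith
      have hu : w - 2 * ε ≤ j * ε := by
        have := mul_le_mul_of_nonneg_right hj2 hεpos.le
        rw [sub_mul, div_mul_cancel₀ _ hεpos.ne'] at this
        linarith
      have hg := (hgrid j hjS).1
      have hm : f * (R n * (j * ε - w)) ≤ f * (R n * (-ε)) := by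
        gcongr
        linarith
      have hq := hgen ω _ (show G n ω (θ + R n * (j * ε)) < F θ by
        have : 2 * δ * R n = f * (R n * ε) / 2 := by rw [hδ]; ring
        have : f * (R n * (-ε)) = -(f * (R n * ε)) := by ring
        linarith)
      refine hu.trans ?_
      rw [le_div_iff₀ hpos]
      linarith
    have hX : ((Q n ω - θ) - (F θ - G n ω θ) / f) / R n = (Q n ω - θ) / R n - w := by
      rw [hw, sub_div]
    simp only [Set.mem_ofPred_eq, sub_zero, hX, Real.norm_eq_abs] at hω
    have : |(Q n ω - θ) / R n - w| ≤ 2 * ε := abs_le.2 ⟨by linarith, by linarith⟩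
    linarith
  rw [Real.dist_eq, sub_zero, abs_of_nonneg measureReal_nonneg]
  calc _ ≤ _ := measureReal_mono hsub
    _ ≤ P.real {ω | K * R n ≤ |G n ω θ - F θ|} + P.real (⋃ j ∈ S, B n j) := measureReal_union_le _ _
    _ ≤ D / K ^ 2 + ∑ j ∈ S, P.real (B n j) :=
      add_le_add (htn K hKpos) (measureReal_biUnion_finset_le _ _)
    _ < η := by linarith

lemma hermiteCoeff_eq_zero_of_lt {h : ℝ → ℝ} {j : ℕ} (hj : (j : ℕ∞) < hermiteRank h) :
    hermiteCoeff h j = 0 := by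
  by_contra hcon
  exact absurd (sInf_le ⟨j, hcon, rfl⟩ : hermiteRank h ≤ j) (not_le.2 hj)

/-- Centring removes the degree 0 coefficient; rank at least 1 is what makes the rate tend to 0. -/
lemma one_le_hermiteRank_hInd {g : ℝ → ℝ} (hg : Measurable g) (u : ℝ) :
    1 ≤ hermiteRank (hInd g u) := by
  refine le_sInf ?_
  rintro _ ⟨j, hj, rfl⟩
  rcases Nat.eq_zero_or_pos j with rfl | h
  · exact absurd (hermiteCoeff_hInd_zero hg u) hj
  · exact_mod_cast h

/-- This puts the moving points ξ(p) + R_n y eventually among the levels over which the minimal rank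
is taken. -/
lemma AssumptionA.iUnion_image_mem_nhds {g : ℝ → ℝ} {p : ℝ} {L : ℕ} {U : Fin L → Set ℝ}
    (hA : AssumptionA g p U) : (⋃ i, g '' U i) ∈ 𝓝 (xi g p) := by
  let i : Fin L := ⟨0, hA.one_le⟩
  obtain ⟨t, ⟨htU, ht⟩, -⟩ := hA.unique_sol i
  obtain ⟨e, hes, heg, -, -⟩ := hA.diffeo i
  have himg : g '' U i = e.target := by
    rw [← e.image_source_eq_target, hes]
    exact (heg.image_eq).symm
  refine mem_of_superset (e.open_target.mem_nhds ?_) (himg ▸ Set.subset_iUnion (fun i => g '' U i) i)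
  rw [← himg]
  exact ⟨t, htU, ht⟩

end GaussBahadur

/-! ### The Bahadur representation for Gaussian subordinated sequences -/

theorem theorem1 {Ω : Type*} [MeasurableSpace Ω] (P : Measure Ω) [IsProbabilityMeasure P]
    (Y : ℕ → Ω → ℝ) (ρ : ℕ → ℝ) (hY : GaussBahadur.IsStationaryGaussian P Y ρ)
    (α : ℝ) (hα : 0 < α)
    (hρ : Asymptotics.IsEquivalent atTop (fun k : ℕ => |ρ k|) (fun k : ℕ => (k : ℝ) ^ (-α)))
    (g : ℝ → ℝ) (hg : Measurable g) (p : ℝ) (hp0 : 0 < p) (hp1 : p < 1)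
    (L : ℕ) (U : Fin L → Set ℝ) (hA : GaussBahadur.AssumptionA g p U) :
    GaussBahadur.IsLittleOInProb P
      (fun n ω =>
        (GaussBahadur.sampleQuantile n (fun i => g (Y i ω)) p - GaussBahadur.xi g p)
          - (p - GaussBahadur.sampleCdf n (fun i => g (Y i ω)) (GaussBahadur.xi g p))
              / GaussBahadur.densG g (GaussBahadur.xi g p))
      (GaussBahadur.rate α (GaussBahadur.tauBar g U)) := by
  open GaussBahadur in
  have hτ : 1 ≤ tauBar g U := le_iInf₂ fun γ _ => one_le_hermiteRank_hInd hg γ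
  obtain ⟨m, hm1, hmτ, hrate⟩ := exists_rate_eq hα hτ
  rw [hrate]
  set R := rate α (m : ℕ∞) with hRdef
  have hRpos : ∀ᶠ n in atTop, 0 < R n := (eventually_ge_atTop 3).mono fun n hn => rate_pos α m hn
  have hR : Tendsto R atTop (𝓝 0) := tendsto_rate hα hm1
  obtain ⟨C, hC0, hC⟩ := exists_sum_abs_pow_div_le hY.abs_le_one hα hρ hm1
  have hf : 0 < densG g (xi g p) := hA.deriv_pos
  have hF : HasDerivAt (cdfG g) (densG g (xi g p)) (xi g p) :=
    (differentiableAt_of_deriv_ne_zero hf.ne').hasDerivAt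
  have hFp : cdfG g (xi g p) = p := cdfG_xi_of_continuousAt hp0 hp1 hF.continuousAt
  have hcoeff : ∀ u ∈ ⋃ i, g '' U i, ∀ j < m, hermiteCoeff (hInd g u) j = 0 := by
    intro u hu j hj
    refine hermiteCoeff_eq_zero_of_lt (lt_of_lt_of_le ?_ (hmτ.trans (iInf₂_le u hu)))
    exact_mod_cast hj
  have hnhds := hA.iUnion_image_mem_nhds
  have hξ := hcoeff _ (mem_of_mem_nhds hnhds)
  have hmain := tendstoInMeasure_bahadur P (G := fun n ω x => sampleCdf n (fun i => g (Y i ω)) x)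
    (Q := fun n ω => sampleQuantile n (fun i => g (Y i ω)) p) (D := 2 * C) hF hf hRpos hR
    (fun n ω x h => sampleQuantile_le hp0 (hFp ▸ h)) ?_ ?_ ?_
  · rw [hFp] at hmain
    exact hmain
  · filter_upwards [eventually_gt_atTop 0] with n hn ω x h
    exact le_sampleQuantile hn hp1.le (hFp ▸ h)
  -- Tightness: E h_θ² ≤ 1 and the factor 2 in the second moment bound give the constant 2C.
  · filter_upwards [eventually_ge_atTop 3, hRpos] with n hn hpos K hK
    have h := hY.measureReal_abs_sum_ge_le (measurable_hInd hg (xi g p)) (memLp_hInd hg _) m hξ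
      (show 0 < n by omega) (mul_pos hK hpos)
    simp_rw [sampleCdf_sub_cdfG _ _ (show 0 < n by omega)] at h
    refine h.trans ?_
    have h0 : 0 ≤ ∫ t, hInd g (xi g p) t ^ 2 ∂(gaussianReal 0 1) :=
      integral_nonneg fun t => sq_nonneg _
    have h1 := mul_le_mul (hC n hn) (integral_sq_hInd_le hg (xi g p)) h0 (by positivity)
    rw [div_le_div_iff₀ (by positivity) (by positivity)]
    rw [← hRdef] at h1
    nlinarith [sq_nonneg K]
  · intro y δ hδ
    have hx : Tendsto (fun n => xi g p + R n * y) atTop (𝓝 (xi g p)) := by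
      simpa using (hR.mul_const y).const_add (xi g p)
    -- In the Chebyshev bound R_n² cancels, leaving this multiple of |F(u) - F(θ)|, which vanishes
    -- by continuity at θ.
    have hlim : Tendsto (fun n => 2 * C / δ ^ 2 *
        |cdfG g (xi g p + R n * y) - cdfG g (xi g p)|) atTop (𝓝 0) := by
      have h := ((hF.continuousAt.tendsto.comp hx).sub_const (cdfG g (xi g p))).abs.const_mul
        (2 * C / δ ^ 2)
      simpa using h
    refine squeeze_zero' (Eventually.of_forall fun n => measureReal_nonneg) ?_ hlim
    filter_upwards [eventually_ge_atTop 3, hRpos, hx.eventually hnhds] with n hn hpos hmem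
    have h := hY.measureReal_abs_sum_ge_le
      ((measurable_hInd hg (xi g p + R n * y)).sub (measurable_hInd hg (xi g p)))
      ((memLp_hInd hg _).sub (memLp_hInd hg _)) m
      (fun j hj => (hermiteCoeff_hInd_sub hg _ _ j).trans (by
        rw [hcoeff _ hmem j hj, hξ j hj, sub_zero]))
      (show 0 < n by omega) (mul_pos hδ hpos)
    simp only [Pi.sub_apply, Finset.sum_sub_distrib, sub_div,
      sampleCdf_sub_cdfG _ _ (show 0 < n by omega)] at h
    simp only [sub_sub_sub_comm (sampleCdf n _ (xi g p + R n * y)) (cdfG g (xi g p + R n * y))] at h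
    refine h.trans ?_
    have h0 : 0 ≤ ∫ t, (hInd g (xi g p + R n * y) t - hInd g (xi g p) t) ^ 2 ∂(gaussianReal 0 1) :=
      integral_nonneg fun t => sq_nonneg _
    have h1 := mul_le_mul (hC n hn) (integral_sq_hInd_sub_le hg (xi g p + R n * y) (xi g p)) h0
      (by positivity)
    rw [← hRdef] at h1
    rw [div_mul_eq_mul_div, div_le_div_iff₀ (by positivity) (by positivity)]
    nlinarith [sq_nonneg δ]
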